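/- Fix $p\ge 0$, $\xi\in[0,2)$, $M\in\mathbb R$, a compact set $\Gamma\subset\mathbb R^p$ and a true parameter $\theta_0=(\mu_0^\dagger,\gamma_0^T)^T$ in the interior of $[-M,M]\times\Gamma\subset\mathbb R^{p+1}$. For every $n$ consider the Erdős–Rényi model with covariates on $n$ nodes: the covariates $Z_{ij}\in\mathbb R^p$, $1\le i<j\le n$, are i.i.d. with a law that does not depend on $n$; this law is centered ($\mathbb E[Z_{12}]=0$), bounded ($|Z_{12,k}|\le c$ almost surely for all $k$ and some constant $c$), and $\mathbb E[Z_{12}Z_{12}^T]$ is positive definite. Given all the covariates, the links $A_{ij}\in\{0,1\}$, $i<j$, are independent with $$P(A_{ij}=1\mid Z)=\frac{\exp(\mu+\gamma_0^TZ_{ij})}{1+\exp(\mu+\gamma_0^TZ_{ij})},\qquad \mu=-\xi\log n+\mu_0^\dagger .$$ Let $\hat\theta=(\hat\mu^\dagger,\hat\gamma^T)^T$ be a (measurable) maximum likelihood estimator, i.e. almost surely a minimizer over $(\mu^\dagger,\gamma)\in[-M,M]\times\Gamma$ of $$\mathcal L^\dagger(\mu^\dagger,\gamma)=-\mu^\dagger\sum_{i<j}A_{ij}-\sum_{i<j}(\gamma^TZ_{ij})A_{ij}+\sum_{i<j}\log\bigl(1+n^{-\xi}\exp(\mu^\dagger+\gamma^TZ_{ij})\bigr).$$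 Put $D_{12}=(1,Z_{12}^T)^T$. If $\xi\in(0,2)$, then $\Sigma=\mathbb E\bigl[D_{12}D_{12}^T\exp(\mu_0^\dagger+\gamma_0^TZ_{12})\bigr]$ is positive definite and, as $n\to\infty$, $$\sqrt{\binom n2\Big/n^{\xi}}\;(\hat\theta-\theta_0)\xrightarrow{\ d\ }\mathcal N(0,\Sigma^{-1}).$$ If $\xi=0$, the same holds with $\Sigma$ replaced by $\mathbb E\Bigl[D_{12}D_{12}^T\,\dfrac{\exp(\mu_0^\dagger+\gamma_0^TZ_{12})}{(1+\exp(\mu_0^\dagger+\gamma_0^TZ_{12}))^2}\Bigr]$. -/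

import Mathlib

open MeasureTheory ProbabilityTheory Filter
open scoped Topology

noncomputable section

namespace ERC

/-- Unordered pairs of distinct nodes of `{0, …, n-1}`, written `i < j`. There are `n.choose 2`. -/
abbrev Dyad (n : ℕ) : Type := {e : Fin n × Fin n // e.1 < e.2}

/-- Stack a scalar and a vector of `ℝ^p` into the vector `(a, v)` of `ℝ^(p+1)`.
A parameter is `θ = (μ†, γ) = stack μ† γ`; a row of the design matrix is `D = (1, z) = stack 1 z`. -/
def stack {p : ℕ} (a : ℝ) (v : EuclideanSpace ℝ (Fin p)) : EuclideanSpace ℝ (Fin (p + 1)) :=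
  WithLp.toLp 2 (Fin.cons a (fun k => v k))

/-- The component `γ` of `θ = (μ†, γ)`; the component `μ†` is `θ 0`. -/
def slope {p : ℕ} (θ : EuclideanSpace ℝ (Fin (p + 1))) : EuclideanSpace ℝ (Fin p) :=
  WithLp.toLp 2 (fun k => θ k.succ)

/-- The parameter space `[-M, M] × Γ`. -/
def paramSpace {p : ℕ} (M : ℝ) (Γ : Set (EuclideanSpace ℝ (Fin p))) :
    Set (EuclideanSpace ℝ (Fin (p + 1))) :=
  {θ | θ 0 ∈ Set.Icc (-M) M ∧ slope θ ∈ Γ}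

/-- Link probability `exp (μ + γᵀz) / (1 + exp (μ + γᵀz))` with `μ = -ξ log n + μ†`. -/
def linkProb {p : ℕ} (n : ℕ) (ξ μd : ℝ) (γ z : EuclideanSpace ℝ (Fin p)) : ℝ :=
  Real.exp ((-ξ * Real.log n + μd) + inner ℝ γ z) /
    (1 + Real.exp ((-ξ * Real.log n + μd) + inner ℝ γ z))

/-- The Erdős–Rényi model with covariates on `n` nodes: the covariates `Z e` are i.i.d. with
law `ν`, and given all covariates the links are independent, `A e` (`true` for an edge) being
present with probability `linkProb n ξ μd γ (Z e)`. The last field is the conditional joint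
probability mass function of the adjacency variables given the σ-algebra generated by all `Z e`. -/
structure IsERC {p : ℕ} {Ω : Type*} [mΩ : MeasurableSpace Ω] (P : Measure Ω)
    (ν : Measure (EuclideanSpace ℝ (Fin p))) (n : ℕ) (ξ μd : ℝ) (γ : EuclideanSpace ℝ (Fin p))
    (Z : Dyad n → Ω → EuclideanSpace ℝ (Fin p)) (A : Dyad n → Ω → Bool) : Prop where
  measurable_covariate : ∀ e, Measurable (Z e)
  measurable_link : ∀ e, Measurable (A e)
  indep_covariate : iIndepFun Z P
  law_covariate : ∀ e, HasLaw (Z e) ν P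
  link_given_covariates : ∀ a : Dyad n → Bool,
    P⟦{ω | ∀ e, A e ω = a e} | MeasurableSpace.comap (fun ω e => Z e ω) MeasurableSpace.pi⟧
      =ᵐ[P] fun ω => ∏ e, if a e = true then linkProb n ξ μd γ (Z e ω)
        else 1 - linkProb n ξ μd γ (Z e ω)

/-- The function `L†(μ†, γ) = - d₊ μ† - ∑_{i<j} (γᵀ z_ij) a_ij
+ ∑_{i<j} log (1 + n^(-ξ) exp (μ† + γᵀ z_ij))` of the parameter `θ = (μ†, γ)`, where `d₊` is the
number of edges: the negative log-likelihood up to a summand independent of `θ`. -/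
def negLogLik {p : ℕ} (n : ℕ) (ξ : ℝ) (z : Dyad n → EuclideanSpace ℝ (Fin p))
    (a : Dyad n → Bool) (θ : EuclideanSpace ℝ (Fin (p + 1))) : ℝ :=
  -(∑ e, if a e = true then (1 : ℝ) else 0) * θ 0
    - (∑ e, inner ℝ (slope θ) (z e) * (if a e = true then (1 : ℝ) else 0))
    + ∑ e, Real.log (1 + (n : ℝ) ^ (-ξ) * Real.exp (θ 0 + inner ℝ (slope θ) (z e)))

/-- `θ` is a maximum likelihood estimate over `K`, i.e. a minimizer of `L†` over `K`. -/
def IsMLE {p : ℕ} (n : ℕ) (ξ : ℝ) (K : Set (EuclideanSpace ℝ (Fin (p + 1))))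
    (z : Dyad n → EuclideanSpace ℝ (Fin p)) (a : Dyad n → Bool)
    (θ : EuclideanSpace ℝ (Fin (p + 1))) : Prop :=
  θ ∈ K ∧ IsMinOn (negLogLik n ξ z a) K θ

/-- The second-moment matrix `E[Z Zᵀ]` for `Z` with law `ν`. -/
def secondMoment {p : ℕ} (ν : Measure (EuclideanSpace ℝ (Fin p))) : Matrix (Fin p) (Fin p) ℝ :=
  Matrix.of fun k l => ∫ z, z k * z l ∂ν

/-- `E[D Dᵀ exp (μ† + γᵀ Z)]` for `Z` with law `ν` and `D = (1, Z)`. -/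
def sparseInfo {p : ℕ} (ν : Measure (EuclideanSpace ℝ (Fin p))) (μd : ℝ)
    (γ : EuclideanSpace ℝ (Fin p)) : Matrix (Fin (p + 1)) (Fin (p + 1)) ℝ :=
  Matrix.of fun k l =>
    ∫ z, stack 1 z k * stack 1 z l * Real.exp (μd + inner ℝ γ z) ∂ν

/-- `E[D Dᵀ exp (μ† + γᵀ Z) / (1 + exp (μ† + γᵀ Z))²]` for `Z` with law `ν` and `D = (1, Z)`:
the Fisher information matrix of logistic regression. -/
def logisticInfo {p : ℕ} (ν : Measure (EuclideanSpace ℝ (Fin p))) (μd : ℝ)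
    (γ : EuclideanSpace ℝ (Fin p)) : Matrix (Fin (p + 1)) (Fin (p + 1)) ℝ :=
  Matrix.of fun k l =>
    ∫ z, stack 1 z k * stack 1 z l *
      (Real.exp (μd + inner ℝ γ z) / (1 + Real.exp (μd + inner ℝ γ z)) ^ 2) ∂ν

end ERC

end

/-! The negative log-likelihood `L` is convex, and this replaces a separate consistency argument.
Put `N = n.choose 2`, `q = n ^ (-ξ)`, `r = √(N q)` and rescale around the truth: `H u = L (θ₀ + u /
r) - L θ₀`. A Taylor expansion of each dyad's term gives, uniformly on bounded sets and in
probability, `H u = -⟨U, u⟩ + ⟨u, S u⟩ / 2 + o(1)`, with `U` the normalized score and `S` the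
limiting information matrix (`abs_negLogLik_sub_quadratic_le`). The quadratic has its minimum at `V
= S⁻¹ U`. A convex function close to it on a ball about `V` exceeds `H V` on the boundary, so all
points with `H ≤ H V` lie in the ball (`norm_sub_lt_of_convexOn_of_near_quadratic`). The rescaled
estimator is such a point as soon as `θ₀ + V / r` lies in the parameter space, so it equals `S⁻¹ U +
o(1)` in probability (`tendsto_measure_norm_mle_sub_score`).

It remains to show that `U` is asymptotically `N(0, S)`. The dyads contribute i.i.d. terms, so the
characteristic function of `U` is the `N`-th power of one integral. A centered Bernoulli variable
with mean parameter `π`, scaled by `y`, has characteristic function `1 - π (1 - π) y² / 2 + O(π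
|y|³)`. Here `π` is of order `q` and `y` of order `1 / r`; since `N q = r²`, the quadratic terms
converge and the total error is `O(1 / r)` (`tendsto_integral_charFun_pow`).

Both regimes are one argument with a parameter `q'`, the limit of `n ^ (-ξ)`: it is 0 in the sparse
case and 1 in the dense case, and `linkWeight q'` is then the exponential or the logistic weight.
The bound `ξ < 2` is what makes `r` tend to infinity. -/

namespace ERC

/-- The weight `exp s / (1 + q exp s)²`: up to the factor `q`, the second derivative of
`s ↦ log (1 + q exp s)`. -/
noncomputable def linkWeight (q s : ℝ) : ℝ := Real.exp s / (1 + q * Real.exp s) ^ 2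

/-! ### The log-partition function `log (1 + q exp s)` and its Taylor bound -/

section LogOnePlusExp

variable {q : ℝ}

lemma one_add_mul_exp_pos (hq : 0 ≤ q) (s : ℝ) : 0 < 1 + q * Real.exp s := by positivity

lemma one_le_one_add_mul_exp (hq : 0 ≤ q) (s : ℝ) : 1 ≤ 1 + q * Real.exp s := by
  have : 0 ≤ q * Real.exp s := by positivity
  linarith

lemma linkWeight_nonneg (q s : ℝ) : 0 ≤ linkWeight q s := by
  unfold linkWeight; positivity

lemma linkWeight_le (hq : 0 ≤ q) (s : ℝ) : linkWeight q s ≤ Real.exp s := by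
  unfold linkWeight
  exact div_le_self (Real.exp_pos s).le (one_le_pow₀ (one_le_one_add_mul_exp hq s))

lemma hasDerivAt_log_one_add_mul_exp (hq : 0 ≤ q) (s : ℝ) :
    HasDerivAt (fun s => Real.log (1 + q * Real.exp s))
      (q * Real.exp s / (1 + q * Real.exp s)) s :=
  (((Real.hasDerivAt_exp s).const_mul q).const_add 1).log (one_add_mul_exp_pos hq s).ne'

lemma hasDerivAt_logistic (hq : 0 ≤ q) (s : ℝ) :
    HasDerivAt (fun s => q * Real.exp s / (1 + q * Real.exp s)) (q * linkWeight q s) s := by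
  have h := (one_add_mul_exp_pos hq s).ne'
  convert! ((Real.hasDerivAt_exp s).const_mul q).div
    (((Real.hasDerivAt_exp s).const_mul q).const_add 1) h using 1
  unfold linkWeight
  field_simp
  ring

lemma hasDerivAt_linkWeight (hq : 0 ≤ q) (s : ℝ) :
    HasDerivAt (linkWeight q)
      (Real.exp s * (1 - q * Real.exp s) / (1 + q * Real.exp s) ^ 3) s := by
  have h := (one_add_mul_exp_pos hq s).ne'
  convert! (Real.hasDerivAt_exp s).div
    ((((Real.hasDerivAt_exp s).const_mul q).const_add 1).pow 2) (pow_ne_zero 2 h) using 1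
  field_simp
  simp
  ring

/-- With `x = q exp s ≥ 0`, `|1 - x| ≤ 1 + x ≤ (1 + x) ^ 3`. The bound is free of `q`, which varies
with `n`. -/
lemma abs_deriv_linkWeight_le (hq : 0 ≤ q) (s : ℝ) :
    |Real.exp s * (1 - q * Real.exp s) / (1 + q * Real.exp s) ^ 3| ≤ Real.exp s := by
  have h := one_add_mul_exp_pos hq s
  have h1 := one_le_one_add_mul_exp hq s
  have h0 : 0 ≤ q * Real.exp s := by positivity
  rw [abs_div, abs_mul, abs_of_pos (Real.exp_pos s), abs_of_pos (pow_pos h 3),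
    div_le_iff₀ (pow_pos h 3)]
  refine mul_le_mul_of_nonneg_left ?_ (Real.exp_pos s).le
  calc |1 - q * Real.exp s| ≤ 1 + q * Real.exp s := abs_le.2 ⟨by linarith, by linarith⟩
    _ ≤ (1 + q * Real.exp s) ^ 3 := le_self_pow₀ h1 (by norm_num)

lemma measurable_linkWeight (q : ℝ) : Measurable (linkWeight q) := by
  unfold linkWeight; fun_prop

lemma convexOn_log_one_add_mul_exp (hq : 0 ≤ q) :
    ConvexOn ℝ Set.univ (fun s => Real.log (1 + q * Real.exp s)) := by
  have hd : deriv (fun s => Real.log (1 + q * Real.exp s)) =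
      fun s => q * Real.exp s / (1 + q * Real.exp s) :=
    funext fun s => (hasDerivAt_log_one_add_mul_exp hq s).deriv
  refine convexOn_univ_of_deriv2_nonneg
    (fun s => (hasDerivAt_log_one_add_mul_exp hq s).differentiableAt) ?_ fun s => ?_
  · rw [hd]
    exact fun s => (hasDerivAt_logistic hq s).differentiableAt
  · rw [Function.iterate_succ, Function.iterate_one, Function.comp_apply, hd,
      (hasDerivAt_logistic hq s).deriv]
    exact mul_nonneg hq (linkWeight_nonneg q s)

end LogOnePlusExp

/-- A second-order Taylor estimate for a function with Lipschitz second derivative. -/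
lemma abs_taylor_two_le {f f' f'' : ℝ → ℝ} {B K : ℝ} (hf : ∀ x, HasDerivAt f (f' x) x)
    (hf' : ∀ x, HasDerivAt f' (f'' x) x)
    (hK : ∀ x ∈ Set.Icc (-B) B, ∀ y ∈ Set.Icc (-B) B, |f'' x - f'' y| ≤ K * |x - y|)
    (hK0 : 0 ≤ K) {s t : ℝ} (hs : s ∈ Set.Icc (-B) B) (ht : t ∈ Set.Icc (-B) B) :
    |f t - f s - f' s * (t - s) - f'' s * (t - s) ^ 2 / 2| ≤ K * |t - s| ^ 3 := by
  have hsub : Set.uIcc s t ⊆ Set.Icc (-B) B := by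
    rw [Set.uIcc]
    exact Set.Icc_subset_Icc (le_min hs.1 ht.1) (max_le hs.2 ht.2)
  have hdist : ∀ x ∈ Set.uIcc s t, |x - s| ≤ |t - s| := fun x hx => by
    rw [Set.uIcc_comm] at hx
    simpa [abs_sub_comm] using Set.abs_sub_right_of_mem_uIcc hx
  -- The mean value inequality is used twice: here for the first-order remainder of `f'`, then for
  -- the second-order remainder of `f`. The constant is not sharp.
  have h1 : ∀ x ∈ Set.uIcc s t, |f' x - f' s - f'' s * (x - s)| ≤ K * |t - s| * |t - s| := by
    intro x hx
    have hd : ∀ y ∈ Set.uIcc s t, HasDerivWithinAt (fun y => f' y - f' s - f'' s * (y - s))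
        (f'' y - f'' s) (Set.uIcc s t) y := fun y _ => by
      have := ((hf' y).sub_const (f' s)).sub (((hasDerivAt_id y).sub_const s).const_mul (f'' s))
      simpa using! this.hasDerivWithinAt
    have := (convex_uIcc s t).norm_image_sub_le_of_norm_hasDerivWithin_le (C := K * |t - s|) hd
      (fun y hy => (hK y (hsub hy) s hs).trans
        (mul_le_mul_of_nonneg_left (hdist y hy) hK0)) Set.left_mem_uIcc hx
    simp only [Real.norm_eq_abs, sub_self, mul_zero, sub_zero] at this
    exact this.trans (mul_le_mul_of_nonneg_left (hdist x hx) (by positivity))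
  have hd : ∀ y ∈ Set.uIcc s t, HasDerivWithinAt
      (fun y => f y - f s - f' s * (y - s) - f'' s * (y - s) ^ 2 / 2)
      (f' y - f' s - f'' s * (y - s)) (Set.uIcc s t) y := fun y _ => by
    have h2 := ((hasDerivAt_id y).sub_const s)
    have := (((hf y).sub_const (f s)).sub (h2.const_mul (f' s))).sub
      (((h2.pow 2).const_mul (f'' s)).div_const 2)
    convert! this.hasDerivWithinAt using 1
    simp
    ring
  have := (convex_uIcc s t).norm_image_sub_le_of_norm_hasDerivWithin_le hd h1
    Set.left_mem_uIcc Set.right_mem_uIcc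
  simp only [Real.norm_eq_abs, sub_self, mul_zero, sub_zero, ne_eq, OfNat.ofNat_ne_zero,
    not_false_eq_true, zero_pow, zero_div] at this
  calc _ ≤ _ := this
    _ = _ := by ring

/-- The factor `q` in the error is essential: `N` terms with increments of order `1 / r` add up to
`N q / r ^ 3 = 1 / r`. -/
lemma abs_log_one_add_mul_exp_taylor_le {q B s t : ℝ} (hq : 0 ≤ q) (hs : |s| ≤ B) (ht : |t| ≤ B) :
    |Real.log (1 + q * Real.exp t) - Real.log (1 + q * Real.exp s)
      - q * Real.exp s / (1 + q * Real.exp s) * (t - s) - q * linkWeight q s * (t - s) ^ 2 / 2|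
      ≤ q * Real.exp B * |t - s| ^ 3 := by
  refine abs_taylor_two_le (B := B) (hasDerivAt_log_one_add_mul_exp hq) (hasDerivAt_logistic hq) ?_
    (by positivity) (abs_le.1 hs) (abs_le.1 ht)
  intro x hx y hy
  have := (convex_Icc (-B) B).norm_image_sub_le_of_norm_hasDerivWithin_le (C := Real.exp B)
    (fun z _ => (hasDerivAt_linkWeight hq z).hasDerivWithinAt)
    (fun z hz => (abs_deriv_linkWeight_le hq z).trans (Real.exp_le_exp.2 hz.2)) hy hx
  rw [← mul_sub, abs_mul, abs_of_nonneg hq, mul_assoc]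
  exact mul_le_mul_of_nonneg_left this hq

/-! ### Sublevel points of convex functions near a quadratic -/

section ConvexArgmin

variable {E : Type*} [NormedAddCommGroup E]

/-- If a convex function is larger on a sphere than at its centre `V`, then every point where it is
at most its value at `V` lies inside the sphere. -/
lemma norm_sub_lt_of_convexOn_of_lt_sphere [NormedSpace ℝ E] {H : E → ℝ}
    (hH : ConvexOn ℝ Set.univ H) {V Y : E} {ε : ℝ} (hε : 0 < ε)
    (hsphere : ∀ u, ‖u - V‖ = ε → H V < H u) (hY : H Y ≤ H V) : ‖Y - V‖ < ε := by
  by_contra! hlt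
  have hρ : 0 < ‖Y - V‖ := hε.trans_le hlt
  -- The segment from `V` to an outside point `Y` meets the sphere at parameter `t`; there convexity
  -- bounds `H` by `H V`, a contradiction.
  set t := ε / ‖Y - V‖ with ht
  have ht0 : 0 ≤ t := by positivity
  have ht1 : t ≤ 1 := (div_le_one hρ).2 hlt
  have hnorm : ‖((1 - t) • V + t • Y) - V‖ = ε := by
    rw [show ((1 - t) • V + t • Y) - V = t • (Y - V) by module, norm_smul, Real.norm_of_nonneg ht0,
      ht, div_mul_cancel₀ _ hρ.ne']
  have h1 := hH.2 (Set.mem_univ V) (Set.mem_univ Y) (sub_nonneg.2 ht1) ht0 (by ring)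
  have h2 := hsphere _ hnorm
  simp only [smul_eq_mul] at h1
  nlinarith

/-- A convex function that is uniformly close to a coercive quadratic around the minimizer `V` of
the quadratic has its sublevel points near `V`. -/
lemma norm_sub_lt_of_convexOn_of_near_quadratic [InnerProductSpace ℝ E] {H : E → ℝ}
    (hH : ConvexOn ℝ Set.univ H) (T : E →L[ℝ] E)
    (hT : ∀ x y, inner ℝ (T x) y = inner ℝ x (T y)) {c : ℝ}
    (hc : ∀ x, c * ‖x‖ ^ 2 ≤ inner ℝ x (T x)) {V Y : E} {ε η : ℝ} (hε : 0 < ε)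
    (hη : 4 * η < c * ε ^ 2)
    (hclose : ∀ u, ‖u - V‖ ≤ ε → |H u - (-inner ℝ (T V) u + inner ℝ u (T u) / 2)| ≤ η)
    (hY : H Y ≤ H V) : ‖Y - V‖ < ε := by
  refine norm_sub_lt_of_convexOn_of_lt_sphere hH hε (fun u hu => ?_) hY
  -- On the sphere the quadratic exceeds its value at `V` by `⟨u - V, T (u - V)⟩ / 2 ≥ c ε² / 2`,
  -- while replacing it by `H` at the two points costs at most `2 η`.
  have h1 := (abs_le.1 (hclose u hu.le)).1
  have h2 := (abs_le.1 (hclose V (by simpa using hε.le))).2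
  have h3 := hc (u - V)
  rw [hu] at h3
  have h4 : inner ℝ (u - V) (T (u - V)) =
      inner ℝ u (T u) - 2 * inner ℝ (T V) u + inner ℝ V (T V) := by
    simp only [map_sub, inner_sub_left, inner_sub_right]
    rw [← hT V u, real_inner_comm (T V) u]
    ring
  rw [h4] at h3
  rw [real_inner_comm V (T V)] at h2
  linarith

end ConvexArgmin

/-- A positive definite matrix is coercive. -/
lemma exists_pos_mul_norm_sq_le_of_posDef {d : ℕ} {S : Matrix (Fin d) (Fin d) ℝ} (hS : S.PosDef) :
    ∃ c > 0, ∀ x : EuclideanSpace ℝ (Fin d),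
      c * ‖x‖ ^ 2 ≤ inner ℝ x (Matrix.toEuclideanCLM (𝕜 := ℝ) S x) := by
  have hpos : ∀ x : EuclideanSpace ℝ (Fin d), x ≠ 0 →
      0 < inner ℝ x (Matrix.toEuclideanCLM (𝕜 := ℝ) S x) := fun x hx => by
    rw [Matrix.inner_toEuclideanCLM]
    simpa using hS.dotProduct_mulVec_pos (x := x.ofLp) (by simpa using hx)
  -- The unit sphere is empty exactly when `d = 0`; otherwise `c` is the minimum of the quadratic
  -- form on it.
  rcases (Metric.sphere (0 : EuclideanSpace ℝ (Fin d)) 1).eq_empty_or_nonempty with he | hne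
  · refine ⟨1, one_pos, fun x => ?_⟩
    have hx : x = 0 := by
      by_contra hx
      have : (‖x‖⁻¹ • x) ∈ Metric.sphere (0 : EuclideanSpace ℝ (Fin d)) 1 := by
        simp [norm_smul, norm_ne_zero_iff.2 hx]
      simp [he] at this
    simp [hx]
  obtain ⟨x₀, hx₀, hmin⟩ := (isCompact_sphere (0 : EuclideanSpace ℝ (Fin d)) 1).exists_isMinOn hne
    (f := fun x => inner ℝ x (Matrix.toEuclideanCLM (𝕜 := ℝ) S x)) (by fun_prop)
  refine ⟨_, hpos x₀ (by rintro rfl; simp at hx₀), fun x => ?_⟩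
  by_cases hx : x = 0
  · simp [hx]
  have hx' := norm_ne_zero_iff.2 hx
  have h := hmin (show (‖x‖⁻¹ • x) ∈ Metric.sphere (0 : EuclideanSpace ℝ (Fin d)) 1 by
    simp [norm_smul, hx'])
  simp only [Set.mem_ofPred_eq, map_smul, inner_smul_left, inner_smul_right, conj_trivial] at h
  calc _ ≤ (‖x‖⁻¹ * (‖x‖⁻¹ * inner ℝ x (Matrix.toEuclideanCLM (𝕜 := ℝ) S x))) * ‖x‖ ^ 2 := by gcongr
    _ = _ := by field_simp

/-! ### Averages and products over independent dyads -/

/-- Chebyshev's inequality for an average of independent bounded identically distributed terms. -/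
lemma measure_abs_average_sub_integral_ge_le {Ω X ι : Type*} [MeasurableSpace Ω] [MeasurableSpace X]
    [Fintype ι] [Nonempty ι] {P : Measure Ω} [IsProbabilityMeasure P] {ν : Measure X}
    {Z : ι → Ω → X}
    (hind : iIndepFun Z P) (hlaw : ∀ i, HasLaw (Z i) ν P)
    {g : X → ℝ} (hg : Measurable g) {C : ℝ} (hC : ∀ᵐ z ∂ν, |g z| ≤ C) {ε : ℝ} (hε : 0 < ε) :
    P {ω | ε ≤ |(Fintype.card ι : ℝ)⁻¹ * ∑ i, g (Z i ω) - ∫ z, g z ∂ν|}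
      ≤ ENNReal.ofReal (C ^ 2 / (Fintype.card ι * ε ^ 2)) := by
  have hN : (0 : ℝ) < Fintype.card ι := by exact_mod_cast Fintype.card_pos
  have hbd : ∀ i, ∀ᵐ ω ∂P, g (Z i ω) ∈ Set.Icc (-C) C := fun i => by
    have := (hlaw i).map_eq ▸ hC
    filter_upwards [ae_of_ae_map (hlaw i).aemeasurable this] with ω hω using abs_le.1 hω
  have hme : ∀ i, AEMeasurable (fun ω => g (Z i ω)) P := fun i =>
    hg.comp_aemeasurable (hlaw i).aemeasurable
  have hL : ∀ i, MemLp (fun ω => g (Z i ω)) 2 P := fun i =>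
    MemLp.of_bound (hme i).aestronglyMeasurable C <| by
      filter_upwards [hbd i] with ω hω using abs_le.2 hω
  have hsum : MemLp (fun ω => ∑ i, g (Z i ω)) 2 P := memLp_finsetSum _ fun i _ => hL i
  have hvar : variance (fun ω => (Fintype.card ι : ℝ)⁻¹ * ∑ i, g (Z i ω)) P
      ≤ C ^ 2 / Fintype.card ι := by
    rw [variance_const_mul]
    have h1 : variance (fun ω => ∑ i, g (Z i ω)) P = ∑ i, variance (fun ω => g (Z i ω)) P := by
      have := IndepFun.variance_sum (X := fun i ω => g (Z i ω)) (s := Finset.univ)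
        (fun i _ => hL i) (fun i _ j _ hij => (hind.indepFun hij).comp hg hg)
      convert! this using 2
      ext ω; simp
    -- Popoviciu's bound: the variance is at most the square of half the length of `[-C, C]`.
    have h2 : ∀ i, variance (fun ω => g (Z i ω)) P ≤ C ^ 2 := fun i => by
      have := variance_le_sq_of_bounded (hbd i) (hme i)
      convert! this using 2
      ring
    rw [h1]
    calc ((Fintype.card ι : ℝ)⁻¹) ^ 2 * ∑ i, variance (fun ω => g (Z i ω)) P
        ≤ ((Fintype.card ι : ℝ)⁻¹) ^ 2 * ∑ _i : ι, C ^ 2 := by gcongr; exact h2 _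
      _ = C ^ 2 / Fintype.card ι := by
        simp only [Finset.sum_const, Finset.card_univ, nsmul_eq_mul]; field_simp
  have hmean : ∫ ω, (Fintype.card ι : ℝ)⁻¹ * ∑ i, g (Z i ω) ∂P = ∫ z, g z ∂ν := by
    rw [integral_const_mul, integral_finsetSum _ fun i _ => (hL i).integrable one_le_two]
    have h3 : ∀ i, ∫ ω, g (Z i ω) ∂P = ∫ z, g z ∂ν := fun i =>
      (hlaw i).integral_comp hg.aestronglyMeasurable
    simp only [h3, Finset.sum_const, Finset.card_univ, nsmul_eq_mul]
    field_simp
  have := meas_ge_le_variance_div_sq (hsum.const_mul (Fintype.card ι : ℝ)⁻¹) hε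
  rw [hmean] at this
  refine this.trans (ENNReal.ofReal_le_ofReal ?_)
  rw [← div_div]
  gcongr

variable {p : ℕ}

lemma measurable_linkProb (n : ℕ) (ξ μd : ℝ) (γ : EuclideanSpace ℝ (Fin p)) :
    Measurable (linkProb n ξ μd γ) := by
  unfold linkProb; fun_prop

lemma linkProb_mem_Icc (n : ℕ) (ξ μd : ℝ) (γ z : EuclideanSpace ℝ (Fin p)) :
    linkProb n ξ μd γ z ∈ Set.Icc 0 1 := by
  unfold linkProb
  refine ⟨by positivity, (div_le_one (by positivity)).2 ?_⟩
  linarith [Real.exp_pos ((-ξ * Real.log n + μd) + inner ℝ γ z)]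


lemma card_dyad (n : ℕ) : Fintype.card (Dyad n) = n.choose 2 := by
  have h : Fintype.card (Dyad n) = ∑ j : Fin n, Fintype.card {i : Fin n // i < j} := by
    rw [← Fintype.card_sigma]
    exact Fintype.card_congr
      { toFun := fun e => ⟨e.1.2, e.1.1, e.2⟩
        invFun := fun x => ⟨(x.2.1, x.1), x.2.2⟩
        left_inv := fun _ => rfl
        right_inv := fun _ => rfl }
  have h2 : ∀ j : Fin n, Fintype.card {i : Fin n // i < j} = (j : ℕ) := fun j => by
    rw [Fintype.card_subtype, Finset.filter_gt_eq_Iio, Fin.card_Iio]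
  rw [h, Finset.sum_congr rfl fun j _ => h2 j, Fin.sum_univ_eq_sum_range (fun i => i) n,
    Finset.sum_range_id, Nat.choose_two_right]

/-- Integrating a function measurable for `m` over an event amounts to weighting it with the
conditional probability of the event given `m`. -/
lemma integral_indicator_smul_eq_of_condExp {Ω : Type*} {m mΩ : MeasurableSpace Ω} (hm : m ≤ mΩ)
    {P : Measure Ω} [IsFiniteMeasure P] {s : Set Ω} (hs : MeasurableSet s) {g : Ω → ℂ}
    (hg : StronglyMeasurable[m] g) {C : ℝ} (hC : ∀ ω, ‖g ω‖ ≤ C) {φ : Ω → ℝ}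
    (hφ : P⟦s | m⟧ =ᵐ[P] φ) :
    Integrable (fun ω => s.indicator (fun _ => (1 : ℝ)) ω • g ω) P ∧
      ∫ ω, s.indicator (fun _ => (1 : ℝ)) ω • g ω ∂P = ∫ ω, φ ω • g ω ∂P := by
  have hint : Integrable (fun ω => s.indicator (fun _ => (1 : ℝ)) ω • g ω) P := by
    refine Integrable.of_bound (C := C) ?_ (ae_of_all _ fun ω => ?_)
    · exact (((measurable_const (a := (1 : ℝ))).indicator hs).aestronglyMeasurable).smul
        (hg.mono hm).aestronglyMeasurable
    · by_cases hω : ω ∈ s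
      · simpa [hω] using hC ω
      · simpa [hω] using (norm_nonneg _).trans (hC ω)
  refine ⟨hint, ?_⟩
  have hpull := condExp_smul_of_aestronglyMeasurable_right (μ := P) (m := m)
    (f := s.indicator (fun _ => (1 : ℝ))) ((integrable_const (1 : ℝ)).indicator hs) hint
    hg.aestronglyMeasurable
  rw [← integral_condExp hm]
  refine integral_congr_ae ?_
  filter_upwards [hpull, hφ] with ω h1 h2
  rw [← h2]
  exact h1

/-- In the Erdős–Rényi model with covariates, the expectation of a product over the dyads of a
function of the covariate and the link factorizes. -/
lemma IsERC.integral_prod {Ω : Type*} [mΩ : MeasurableSpace Ω] {P : Measure Ω}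
    [IsProbabilityMeasure P] {ν : Measure (EuclideanSpace ℝ (Fin p))} [IsProbabilityMeasure ν]
    {n : ℕ} {ξ μd : ℝ}
    {γ : EuclideanSpace ℝ (Fin p)} {Z : Dyad n → Ω → EuclideanSpace ℝ (Fin p)}
    {A : Dyad n → Ω → Bool} (h : IsERC P ν n ξ μd γ Z A)
    {f : EuclideanSpace ℝ (Fin p) → Bool → ℂ} (hf : ∀ a, Measurable fun z => f z a)
    (hf1 : ∀ z a, ‖f z a‖ ≤ 1) :
    ∫ ω, ∏ e, f (Z e ω) (A e ω) ∂P =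
      (∫ z, ((linkProb n ξ μd γ z : ℂ) * f z true
        + (1 - (linkProb n ξ μd γ z : ℂ)) * f z false) ∂ν) ^ (n.choose 2) := by
  set w : EuclideanSpace ℝ (Fin p) → Bool → ℝ :=
    fun z a => if a = true then linkProb n ξ μd γ z else 1 - linkProb n ξ μd γ z with hw
  have hwm : ∀ a, Measurable fun z => w z a := fun a => by
    have := measurable_linkProb n ξ μd γ
    cases a
    · simpa [hw] using this.const_sub 1
    · simpa [hw] using this
  have hw1 : ∀ z a, ‖w z a‖ ≤ 1 := fun z a => by
    have := linkProb_mem_Icc n ξ μd γ z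
    rw [Real.norm_eq_abs, abs_le]
    cases a <;> simp [hw] <;> constructor <;> linarith [this.1, this.2]
  have hwf : ∀ a, Measurable fun z => (w z a : ℂ) * f z a := fun a =>
    (Complex.measurable_ofReal.comp (hwm a)).mul (hf a)
  have hwfi : ∀ a, Integrable (fun z => (w z a : ℂ) * f z a) ν := fun a =>
    Integrable.of_bound (C := 1) (hwf a).aestronglyMeasurable <| ae_of_all _ fun z => by
      rw [norm_mul, Complex.norm_real]
      exact mul_le_one₀ (hw1 z a) (norm_nonneg _) (hf1 z a)
  have hmle := (measurable_pi_lambda (fun ω e => Z e ω) h.measurable_covariate).comap_le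
  set S : (Dyad n → Bool) → Set Ω := fun a => {ω | ∀ e, A e ω = a e} with hS
  have hSm : ∀ a, MeasurableSet (S a) := fun a => by
    have : S a = ⋂ e, A e ⁻¹' {a e} := by ext; simp [hS]
    rw [this]
    exact MeasurableSet.iInter fun e => h.measurable_link e (measurableSet_singleton _)
  -- Summing over all adjacency configurations freezes the links, so that the conditional mass
  -- function and the independence of the covariates apply to each summand; the sum of products is
  -- refactored at the end.
  have hdecomp : ∀ ω, ∏ e, f (Z e ω) (A e ω) =
      ∑ a : Dyad n → Bool, (S a).indicator (fun _ => (1 : ℝ)) ω • ∏ e, f (Z e ω) (a e) := by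
    intro ω
    rw [Finset.sum_eq_single (fun e => A e ω)]
    · simp [hS]
    · intro a _ ha
      rw [Set.indicator_of_notMem, zero_smul]
      exact fun hmem => ha (funext fun e => (hmem e).symm)
    · simp
  have hterm : ∀ a : Dyad n → Bool,
      Integrable (fun ω => (S a).indicator (fun _ => (1 : ℝ)) ω • ∏ e, f (Z e ω) (a e)) P ∧
      ∫ ω, (S a).indicator (fun _ => (1 : ℝ)) ω • ∏ e, f (Z e ω) (a e) ∂P =
        ∏ e, ∫ z, (w z (a e) : ℂ) * f z (a e) ∂ν := by
    intro a
    obtain ⟨hi, he⟩ := integral_indicator_smul_eq_of_condExp hmle (hSm a)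
      (g := fun ω => ∏ e, f (Z e ω) (a e)) (C := 1)
      (Measurable.stronglyMeasurable <|
        (Finset.measurable_fun_prod _ fun e _ => (hf (a e)).comp (measurable_pi_apply e)).comp
          (comap_measurable (fun ω e => Z e ω)))
      (fun ω => by
        rw [norm_prod]
        exact Finset.prod_le_one (fun _ _ => norm_nonneg _) fun e _ => hf1 _ _)
      (h.link_given_covariates a)
    refine ⟨hi, he.trans ?_⟩
    calc _ = ∫ ω, ∏ e, ((w (Z e ω) (a e) : ℂ) * f (Z e ω) (a e)) ∂P := by
          refine integral_congr_ae (ae_of_all _ fun ω => ?_)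
          simp only [Complex.real_smul, Finset.prod_mul_distrib]
          push_cast
          rfl
      _ = ∏ e, ∫ ω, (w (Z e ω) (a e) : ℂ) * f (Z e ω) (a e) ∂P :=
          h.indep_covariate.integral_fun_prod_comp (f := fun e z => (w z (a e) : ℂ) * f z (a e))
            (fun e => (h.measurable_covariate e).aemeasurable)
            fun e => (hwf (a e)).aestronglyMeasurable
      _ = _ := Finset.prod_congr rfl fun e _ =>
          (h.law_covariate e).integral_comp (f := fun z => (w z (a e) : ℂ) * f z (a e))
            (hwf (a e)).aestronglyMeasurable
  simp_rw [hdecomp]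
  rw [integral_finsetSum _ fun a _ => (hterm a).1, Finset.sum_congr rfl fun a _ => (hterm a).2,
    ← Fintype.prod_sum (fun (_ : Dyad n) (b : Bool) => ∫ z, (w z b : ℂ) * f z b ∂ν),
    Finset.prod_const, Finset.card_univ, card_dyad, Fintype.sum_bool,
    ← integral_add (hwfi true) (hwfi false)]
  simp [hw]

/-! ### Design vectors and the information matrix -/

@[simp] lemma stack_zero (a : ℝ) (v : EuclideanSpace ℝ (Fin p)) : stack a v 0 = a := rfl

@[simp] lemma stack_succ (a : ℝ) (v : EuclideanSpace ℝ (Fin p)) (k : Fin p) :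
    stack a v k.succ = v k := rfl

@[simp] lemma slope_stack (a : ℝ) (v : EuclideanSpace ℝ (Fin p)) : slope (stack a v) = v := rfl

@[simp] lemma slope_apply (θ : EuclideanSpace ℝ (Fin (p + 1))) (k : Fin p) :
    slope θ k = θ k.succ := rfl

lemma inner_stack_one (θ : EuclideanSpace ℝ (Fin (p + 1))) (z : EuclideanSpace ℝ (Fin p)) :
    inner ℝ θ (stack 1 z) = θ 0 + inner ℝ (slope θ) z := by
  simp [PiLp.inner_apply, Fin.sum_univ_succ]

lemma measurable_stack (a : ℝ) :
    Measurable (stack a : EuclideanSpace ℝ (Fin p) → EuclideanSpace ℝ (Fin (p + 1))) := by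
  refine (PiLp.continuous_toLp 2 _).measurable.comp (measurable_pi_lambda _ fun k => ?_)
  refine Fin.cases ?_ (fun k => ?_) k
  · simp
  · simp only [Fin.cons_succ]; fun_prop

lemma norm_stack_one_le {z : EuclideanSpace ℝ (Fin p)} {c : ℝ} (h : ∀ k, |z k| ≤ c) :
    ‖stack 1 z‖ ≤ Real.sqrt (1 + p * c ^ 2) := by
  rw [EuclideanSpace.norm_eq]
  refine Real.sqrt_le_sqrt ?_
  rw [Fin.sum_univ_succ]
  have : ∑ k : Fin p, ‖stack 1 z k.succ‖ ^ 2 ≤ ∑ _k : Fin p, c ^ 2 :=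
    Finset.sum_le_sum fun k _ => by
      simpa using sq_le_sq' (by linarith [(abs_le.1 (h k)).1]) (abs_le.1 (h k)).2
  simpa using this

lemma abs_coord_le_norm {d : ℕ} (x : EuclideanSpace ℝ (Fin d)) (k : Fin d) : |x k| ≤ ‖x‖ := by
  simpa using PiLp.norm_apply_le x k

/-- The matrix `E[D Dᵀ w]`, where `D = (1, Z)`, `Z` has law `ν` and `w` is the link weight with
parameter `q` at `θᵀ D`. -/
noncomputable def info (ν : Measure (EuclideanSpace ℝ (Fin p)))
    (θ : EuclideanSpace ℝ (Fin (p + 1))) (q : ℝ) : Matrix (Fin (p + 1)) (Fin (p + 1)) ℝ :=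
  Matrix.of fun k l =>
    ∫ z, stack 1 z k * stack 1 z l * linkWeight q (inner ℝ θ (stack 1 z)) ∂ν

lemma sparseInfo_eq_info (ν : Measure (EuclideanSpace ℝ (Fin p))) (μ : ℝ)
    (γ : EuclideanSpace ℝ (Fin p)) : sparseInfo ν μ γ = info ν (stack μ γ) 0 := by
  simp [sparseInfo, info, linkWeight, inner_stack_one]

lemma logisticInfo_eq_info (ν : Measure (EuclideanSpace ℝ (Fin p))) (μ : ℝ)
    (γ : EuclideanSpace ℝ (Fin p)) : logisticInfo ν μ γ = info ν (stack μ γ) 1 := by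
  simp [logisticInfo, info, linkWeight, inner_stack_one]

lemma isHermitian_info (ν : Measure (EuclideanSpace ℝ (Fin p)))
    (θ : EuclideanSpace ℝ (Fin (p + 1))) (q : ℝ) : (info ν θ q).IsHermitian := by
  ext k l
  simp only [Matrix.conjTranspose_apply, info, Matrix.of_apply, star_trivial]
  refine integral_congr_ae (ae_of_all _ fun z => ?_)
  simp only
  ring

section Info

variable {ν : Measure (EuclideanSpace ℝ (Fin p))} [IsProbabilityMeasure ν] {b : ℝ}
  {θ : EuclideanSpace ℝ (Fin (p + 1))} {q : ℝ}

lemma abs_inner_stack_le {z : EuclideanSpace ℝ (Fin p)} (hz : ‖stack 1 z‖ ≤ b)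
    (x : EuclideanSpace ℝ (Fin (p + 1))) : |inner ℝ x (stack 1 z)| ≤ ‖x‖ * b :=
  (abs_real_inner_le_norm _ _).trans (by gcongr)

lemma linkWeight_inner_stack_le (hq : 0 ≤ q) {z : EuclideanSpace ℝ (Fin p)}
    (hz : ‖stack 1 z‖ ≤ b) :
    linkWeight q (inner ℝ θ (stack 1 z)) ≤ Real.exp (‖θ‖ * b) :=
  (linkWeight_le hq _).trans (Real.exp_le_exp.2 (abs_le.1 (abs_inner_stack_le hz θ)).2)

lemma measurable_linkWeight_inner_stack (q : ℝ) (θ : EuclideanSpace ℝ (Fin (p + 1))) :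
    Measurable fun z : EuclideanSpace ℝ (Fin p) => linkWeight q (inner ℝ θ (stack 1 z)) :=
  (measurable_linkWeight q).comp ((measurable_stack 1).const_inner)

lemma measurable_coord_mul_linkWeight (q : ℝ) (θ : EuclideanSpace ℝ (Fin (p + 1)))
    (k l : Fin (p + 1)) :
    Measurable fun z : EuclideanSpace ℝ (Fin p) =>
      stack 1 z k * stack 1 z l * linkWeight q (inner ℝ θ (stack 1 z)) := by
  have h : ∀ k, Measurable fun z : EuclideanSpace ℝ (Fin p) => stack 1 z k := fun k =>
    (EuclideanSpace.proj (𝕜 := ℝ) k).continuous.measurable.comp (measurable_stack 1)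
  exact ((h k).mul (h l)).mul (measurable_linkWeight_inner_stack q θ)

lemma abs_coord_mul_linkWeight_le (hq : 0 ≤ q) {z : EuclideanSpace ℝ (Fin p)}
    (hz : ‖stack 1 z‖ ≤ b) (k l : Fin (p + 1)) :
    |stack 1 z k * stack 1 z l * linkWeight q (inner ℝ θ (stack 1 z))|
      ≤ b * b * Real.exp (‖θ‖ * b) := by
  have hb : 0 ≤ b := (norm_nonneg _).trans hz
  rw [abs_mul, abs_mul, abs_of_nonneg (linkWeight_nonneg _ _)]
  gcongr
  · exact linkWeight_nonneg _ _
  · exact (abs_coord_le_norm _ k).trans hz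
  · exact (abs_coord_le_norm _ l).trans hz
  · exact linkWeight_inner_stack_le hq hz

lemma integrable_coord_mul_linkWeight (hq : 0 ≤ q) (hb : ∀ᵐ z ∂ν, ‖stack 1 z‖ ≤ b)
    (k l : Fin (p + 1)) :
    Integrable (fun z => stack 1 z k * stack 1 z l * linkWeight q (inner ℝ θ (stack 1 z))) ν := by
  refine Integrable.of_bound (measurable_coord_mul_linkWeight q θ k l).aestronglyMeasurable
    (b * b * Real.exp (‖θ‖ * b)) ?_
  filter_upwards [hb] with z hz using abs_coord_mul_linkWeight_le hq hz k l

/-- Dominated convergence: `linkWeight q s ≤ exp s` for every `q ≥ 0` gives a constant bound. This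
absorbs the dependence of the expected information on `n`. -/
lemma tendsto_info {qs : ℕ → ℝ} (hqs : ∀ᶠ n in atTop, 0 ≤ qs n) (hq : 0 ≤ q)
    (hlim : Tendsto qs atTop (𝓝 q)) (hb : ∀ᵐ z ∂ν, ‖stack 1 z‖ ≤ b) (k l : Fin (p + 1)) :
    Tendsto (fun n => info ν θ (qs n) k l) atTop (𝓝 (info ν θ q k l)) := by
  refine tendsto_integral_filter_of_dominated_convergence
    (fun _ => b * b * Real.exp (‖θ‖ * b))
    (Eventually.of_forall fun n => (measurable_coord_mul_linkWeight _ θ k l).aestronglyMeasurable)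
    ?_ (integrable_const _) (ae_of_all _ fun z => ?_)
  · filter_upwards [hqs] with n hn
    filter_upwards [hb] with z hz using abs_coord_mul_linkWeight_le hn hz k l
  · refine Tendsto.const_mul _ ?_
    unfold linkWeight
    refine Tendsto.div tendsto_const_nhds (((hlim.mul_const _).const_add 1).pow 2) ?_
    exact (pow_pos (one_add_mul_exp_pos hq _) 2).ne'

/-- This form of the quadratic form yields both positive definiteness and the limiting variance of
the score. -/
lemma inner_toEuclideanCLM_info (hq : 0 ≤ q) (hb : ∀ᵐ z ∂ν, ‖stack 1 z‖ ≤ b)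
    (x : EuclideanSpace ℝ (Fin (p + 1))) :
    inner ℝ x (Matrix.toEuclideanCLM (𝕜 := ℝ) (info ν θ q) x) =
      ∫ z, inner ℝ x (stack 1 z) ^ 2 * linkWeight q (inner ℝ θ (stack 1 z)) ∂ν := by
  have h : ∀ z : EuclideanSpace ℝ (Fin p),
      inner ℝ x (stack 1 z) ^ 2 * linkWeight q (inner ℝ θ (stack 1 z)) =
      ∑ k, ∑ l, x k * x l *
        (stack 1 z k * stack 1 z l * linkWeight q (inner ℝ θ (stack 1 z))) := fun z => by
    rw [sq, PiLp.inner_apply x, Finset.sum_mul_sum, Finset.sum_mul]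
    refine Finset.sum_congr rfl fun k _ => ?_
    rw [Finset.sum_mul]
    refine Finset.sum_congr rfl fun l _ => ?_
    simp
    ring
  simp_rw [h]
  rw [integral_finsetSum _ fun k _ => integrable_finsetSum _ fun l _ =>
    (integrable_coord_mul_linkWeight hq hb k l).const_mul _, Matrix.inner_toEuclideanCLM]
  simp only [dotProduct, Matrix.mulVec, Finset.mul_sum]
  refine Finset.sum_congr rfl fun k _ => ?_
  rw [integral_finsetSum _ fun l _ => (integrable_coord_mul_linkWeight hq hb k l).const_mul _]
  refine Finset.sum_congr rfl fun l _ => ?_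
  rw [integral_const_mul]
  simp only [info, Matrix.of_apply]
  ring

/-- The information matrix is positive definite when the covariates are centered, bounded and have
a positive definite second-moment matrix. -/
lemma posDef_info (hq : 0 ≤ q) {c : ℝ} (hbdd : ∀ᵐ z ∂ν, ∀ k, |z k| ≤ c)
    (hcent : ∀ k, ∫ z, z k ∂ν = 0) (hpos : (secondMoment ν).PosDef) : (info ν θ q).PosDef := by
  have hb : ∀ᵐ z ∂ν, ‖stack 1 z‖ ≤ Real.sqrt (1 + p * c ^ 2) := by
    filter_upwards [hbdd] with z hz using norm_stack_one_le hz
  set b := Real.sqrt (1 + p * c ^ 2)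
  refine Matrix.PosDef.of_dotProduct_mulVec_pos (isHermitian_info ν θ q) fun x hx => ?_
  have key := inner_toEuclideanCLM_info (θ := θ) hq hb (WithLp.toLp 2 x)
  rw [Matrix.inner_toEuclideanCLM] at key
  rw [star_trivial]
  change x ⬝ᵥ (info ν θ q).mulVec x = _ at key
  rw [key]
  set y : EuclideanSpace ℝ (Fin (p + 1)) := WithLp.toLp 2 x
  have hme : Measurable fun z : EuclideanSpace ℝ (Fin p) =>
      inner ℝ y (stack 1 z) ^ 2 * linkWeight q (inner ℝ θ (stack 1 z)) :=
    (((measurable_stack 1).const_inner).pow_const 2).mul (measurable_linkWeight_inner_stack q θ)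
  have hnn : ∀ z : EuclideanSpace ℝ (Fin p),
      0 ≤ inner ℝ y (stack 1 z) ^ 2 * linkWeight q (inner ℝ θ (stack 1 z)) := fun z =>
    mul_nonneg (sq_nonneg _) (linkWeight_nonneg _ _)
  have hint : Integrable (fun z => inner ℝ y (stack 1 z) ^ 2 *
      linkWeight q (inner ℝ θ (stack 1 z))) ν := by
    refine Integrable.of_bound hme.aestronglyMeasurable
      ((‖y‖ * b) ^ 2 * Real.exp (‖θ‖ * b)) ?_
    filter_upwards [hb] with z hz
    rw [Real.norm_of_nonneg (hnn z), ← sq_abs]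
    gcongr
    · exact linkWeight_nonneg _ _
    · exact abs_inner_stack_le hz y
    · exact linkWeight_inner_stack_le hq hz
  -- If the form vanishes at `y`, positivity of the weight forces `y 0 + ⟨slope y, Z⟩ = 0` almost
  -- surely. Taking means gives `y 0 = 0` by centering, and then the second-moment matrix forces
  -- `slope y = 0`.
  refine lt_of_le_of_ne (integral_nonneg hnn) fun h0 => ?_
  rw [eq_comm, integral_eq_zero_iff_of_nonneg hnn hint] at h0
  have hzero : ∀ᵐ z ∂ν, y 0 + inner ℝ (slope y) z = 0 := by
    filter_upwards [h0] with z hz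
    have hw : linkWeight q (inner ℝ θ (stack 1 z)) ≠ 0 := by
      unfold linkWeight
      have := one_add_mul_exp_pos hq (inner ℝ θ (stack 1 z))
      positivity
    rw [← inner_stack_one]
    simpa [hw] using hz
  have hzi : ∀ k, Integrable (fun z : EuclideanSpace ℝ (Fin p) => z k) ν := fun k => by
    refine Integrable.of_bound
      (EuclideanSpace.proj (𝕜 := ℝ) k).continuous.measurable.aestronglyMeasurable c ?_
    filter_upwards [hbdd] with z hz using hz k
  have hmean : ∫ z, inner ℝ (slope y) z ∂ν = 0 := by
    simp only [PiLp.inner_apply, RCLike.inner_apply, conj_trivial]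
    rw [integral_finsetSum _ fun k _ => (hzi k).mul_const _]
    exact Finset.sum_eq_zero fun k _ => by rw [integral_mul_const, hcent k, zero_mul]
  have hy0 : y 0 = 0 := by
    have h1 : ∫ z, inner ℝ (slope y) z ∂ν = ∫ _z, -y 0 ∂ν :=
      integral_congr_ae (by filter_upwards [hzero] with z hz; linarith)
    rw [hmean] at h1
    simpa using h1.symm
  have hslope : (fun k : Fin p => y k.succ) = 0 := by
    by_contra hne
    have h2 := hpos.dotProduct_mulVec_pos hne
    have h3 : star (fun k : Fin p => y k.succ) ⬝ᵥ
        (secondMoment ν).mulVec (fun k : Fin p => y k.succ) =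
        ∫ z, inner ℝ (slope y) z ^ 2 ∂ν := by
      have hzz : ∀ k l, Integrable (fun z : EuclideanSpace ℝ (Fin p) => z k * z l) ν :=
        fun k l => by
          refine (hzi l).bdd_mul (c := c) (hzi k).aestronglyMeasurable ?_
          filter_upwards [hbdd] with z hz using hz k
      have h4 : ∀ z : EuclideanSpace ℝ (Fin p), inner ℝ (slope y) z ^ 2 =
          ∑ k, ∑ l, y k.succ * y l.succ * (z k * z l) := fun z => by
        rw [sq, PiLp.inner_apply, Finset.sum_mul_sum]
        refine Finset.sum_congr rfl fun k _ => Finset.sum_congr rfl fun l _ => ?_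
        simp
        ring
      simp_rw [h4]
      rw [integral_finsetSum _ fun k _ => integrable_finsetSum _ fun l _ =>
        (hzz k l).const_mul _]
      simp only [dotProduct, Matrix.mulVec, Finset.mul_sum, star_trivial]
      refine Finset.sum_congr rfl fun k _ => ?_
      rw [integral_finsetSum _ fun l _ => (hzz k l).const_mul _]
      refine Finset.sum_congr rfl fun l _ => ?_
      rw [integral_const_mul]
      simp only [secondMoment, Matrix.of_apply]
      ring
    rw [h3, integral_eq_zero_of_ae] at h2
    · exact lt_irrefl _ h2
    · filter_upwards [hzero] with z hz
      rw [hy0, zero_add] at hz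
      simp [hz]
  refine hx (funext fun k => ?_)
  refine Fin.cases ?_ (fun k => ?_) k
  · exact hy0
  · exact congrFun hslope k

end Info

/-! ### Characteristic function of the normalized score -/

/-- If `N n → ∞` and `N n * g n → t`, then `(1 + g n) ^ N n → exp t`. -/
lemma tendsto_one_add_pow_exp_of_tendsto_mul {N : ℕ → ℕ} (hN : Tendsto N atTop atTop) {g : ℕ → ℂ}
    {t : ℂ} (h : Tendsto (fun n => (N n : ℂ) * g n) atTop (𝓝 t)) :
    Tendsto (fun n => (1 + g n) ^ N n) atTop (𝓝 (Complex.exp t)) := by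
  have hNinv : Tendsto (fun n => ((N n : ℂ))⁻¹) atTop (𝓝 0) :=
    tendsto_inv₀_cobounded.comp ((tendsto_natCast_atTop_cobounded (α := ℂ)).comp hN)
  have hg : Tendsto g atTop (𝓝 0) := by
    have := hNinv.mul h
    rw [zero_mul] at this
    refine this.congr' ?_
    filter_upwards [hN.eventually_ge_atTop 1] with n hn
    have : (N n : ℂ) ≠ 0 := by exact_mod_cast (Nat.one_le_iff_ne_zero.1 hn)
    field_simp
  have hsmall : ∀ᶠ n in atTop, ‖g n‖ < 1 / 2 := by
    have := hg.norm
    rw [norm_zero] at this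
    exact this.eventually_lt_const (by norm_num)
  -- For small `g`, `|log (1 + g) - g| ≤ |g|²`, and `N |g|² = |N g| |g|` tends to 0.
  have herr : Tendsto (fun n => (N n : ℂ) * (Complex.log (1 + g n) - g n)) atTop (𝓝 0) := by
    have h0 : Tendsto (fun n => ‖(N n : ℂ) * g n‖ * ‖g n‖) atTop (𝓝 0) := by
      simpa using h.norm.mul hg.norm
    refine squeeze_zero_norm' ?_ h0
    filter_upwards [hsmall] with n hn
    rw [norm_mul, norm_mul, mul_assoc]
    gcongr
    refine (Complex.norm_log_one_add_sub_self_le (by linarith)).trans ?_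
    have : (1 - ‖g n‖)⁻¹ ≤ 2 := by
      rw [inv_le_comm₀ (by linarith) (by norm_num)]
      linarith
    nlinarith [sq_nonneg ‖g n‖]
  have hlog : Tendsto (fun n => (N n : ℂ) * Complex.log (1 + g n)) atTop (𝓝 t) := by
    have := h.add herr
    rw [add_zero] at this
    exact this.congr fun n => by ring
  refine ((Complex.continuous_exp.tendsto t).comp hlog).congr' ?_
  filter_upwards [hsmall] with n hn
  have hne : 1 + g n ≠ 0 := fun h0 => by
    have h1 : g n = -1 := by linear_combination h0
    rw [h1] at hn
    norm_num at hn
  rw [Function.comp_apply, Complex.exp_nat_mul, Complex.exp_log hne]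

lemma norm_exp_mul_I_sub_le {y : ℝ} (hy : |y| ≤ 1) :
    ‖Complex.exp (y * Complex.I) - (1 + y * Complex.I - (y : ℂ) ^ 2 / 2)‖ ≤ |y| ^ 3 := by
  have hn : ‖(y : ℂ) * Complex.I‖ = |y| := by simp
  have h := Complex.exp_bound (x := (y : ℂ) * Complex.I) (by rwa [hn]) (n := 3) (by norm_num)
  rw [hn] at h
  have he : ∑ m ∈ Finset.range 3, ((y : ℂ) * Complex.I) ^ m / (m.factorial : ℂ) =
      1 + y * Complex.I - (y : ℂ) ^ 2 / 2 := by
    simp [Finset.sum_range_succ, Nat.factorial, mul_pow]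
    ring
  rw [he] at h
  refine h.trans (mul_le_of_le_one_right (by positivity) ?_)
  norm_num [Nat.factorial]

/-- Second-order expansion of the characteristic function of a centered Bernoulli variable. -/
lemma norm_bernoulli_charFun_sub_le {π y : ℝ} (hπ : π ∈ Set.Icc 0 1) (hy : |y| ≤ 1) :
    ‖(π : ℂ) * Complex.exp (((1 - π) * y : ℝ) * Complex.I)
      + (1 - π) * Complex.exp (((0 - π) * y : ℝ) * Complex.I) - 1
      + ((π * (1 - π) * y ^ 2 / 2 : ℝ) : ℂ)‖ ≤ 2 * π * |y| ^ 3 := by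
  obtain ⟨h0, h1⟩ := hπ
  have ha : |(1 - π) * y| = (1 - π) * |y| := by rw [abs_mul, abs_of_nonneg (by linarith)]
  have hb : |(0 - π) * y| = π * |y| := by rw [abs_mul, zero_sub, abs_neg, abs_of_nonneg h0]
  have hya := abs_nonneg y
  have e1 := norm_exp_mul_I_sub_le (y := (1 - π) * y) (by rw [ha]; nlinarith)
  have e2 := norm_exp_mul_I_sub_le (y := (0 - π) * y) (by rw [hb]; nlinarith)
  rw [ha] at e1
  rw [hb] at e2
  set E1 := Complex.exp (((1 - π) * y : ℝ) * Complex.I)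
  set E2 := Complex.exp (((0 - π) * y : ℝ) * Complex.I)
  -- The linear terms cancel by centering, and `π (1 - π)² + (1 - π) π² = π (1 - π)`.
  have heq : (π : ℂ) * E1 + (1 - π) * E2 - 1 + ((π * (1 - π) * y ^ 2 / 2 : ℝ) : ℂ) =
      (π : ℂ) * (E1 - (1 + ((1 - π) * y : ℝ) * Complex.I - (((1 - π) * y : ℝ) : ℂ) ^ 2 / 2)) +
      ((1 - π : ℝ) : ℂ) *
        (E2 - (1 + ((0 - π) * y : ℝ) * Complex.I - (((0 - π) * y : ℝ) : ℂ) ^ 2 / 2)) := by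
    push_cast
    ring
  rw [heq]
  have hy3 : 0 ≤ |y| ^ 3 := by positivity
  calc _ ≤ π * ((1 - π) * |y|) ^ 3 + (1 - π) * (π * |y|) ^ 3 := by
        refine (norm_add_le _ _).trans ?_
        rw [norm_mul, norm_mul, Complex.norm_real, Complex.norm_real, Real.norm_of_nonneg h0,
          Real.norm_of_nonneg (sub_nonneg.2 h1)]
        gcongr
    _ ≤ π * |y| ^ 3 + 1 * (π * |y| ^ 3) := by
        have h2 : (1 - π) ^ 3 ≤ 1 := pow_le_one₀ (by linarith) (by linarith)
        -- One factor `π` must survive: in the sparse regime it compensates the number of dyads.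
        have h3 : π ^ 3 ≤ π := pow_le_of_le_one h0 h1 (by norm_num)
        rw [mul_pow, mul_pow]
        gcongr
        · exact mul_le_of_le_one_left hy3 h2
        · linarith
    _ = _ := by ring

/-- The integrated characteristic function of a rescaled score, raised to the number of terms,
tends to the characteristic function of the normal law with covariance the information matrix. -/
lemma tendsto_integral_charFun_pow {ν : Measure (EuclideanSpace ℝ (Fin p))}
    [IsProbabilityMeasure ν] {b : ℝ} (hb : ∀ᵐ z ∂ν, ‖stack 1 z‖ ≤ b)
    {θ : EuclideanSpace ℝ (Fin (p + 1))} {N : ℕ → ℕ} {q r : ℕ → ℝ} {q' : ℝ}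
    (hq : ∀ᶠ n in atTop, 0 < q n) (hr2 : ∀ᶠ n in atTop, r n ^ 2 = N n * q n)
    (hr : Tendsto r atTop atTop) (hN : Tendsto N atTop atTop) (hq' : 0 ≤ q')
    (hqq : Tendsto q atTop (𝓝 q')) {π : ℕ → EuclideanSpace ℝ (Fin p) → ℝ}
    (hπm : ∀ n, Measurable (π n)) (hπ01 : ∀ n z, π n z ∈ Set.Icc 0 1)
    (hπ : ∀ᶠ n in atTop, ∀ z, π n z = q n * Real.exp (inner ℝ θ (stack 1 z)) /
      (1 + q n * Real.exp (inner ℝ θ (stack 1 z))))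
    (t : EuclideanSpace ℝ (Fin (p + 1))) :
    Tendsto (fun n => (∫ z, ((π n z : ℂ) *
        Complex.exp (((1 - π n z) * ((r n)⁻¹ * inner ℝ t (stack 1 z)) : ℝ) * Complex.I)
      + (1 - (π n z : ℂ)) *
        Complex.exp (((0 - π n z) * ((r n)⁻¹ * inner ℝ t (stack 1 z)) : ℝ) * Complex.I)) ∂ν) ^ N n)
      atTop (𝓝 (Complex.exp
        (-(inner ℝ t (Matrix.toEuclideanCLM (𝕜 := ℝ) (info ν θ q') t) / 2 : ℝ)))) := by
  set v : EuclideanSpace ℝ (Fin p) → ℝ := fun z => inner ℝ t (stack 1 z) with hv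
  set G : ℕ → EuclideanSpace ℝ (Fin p) → ℂ := fun n z => (π n z : ℂ) *
      Complex.exp (((1 - π n z) * ((r n)⁻¹ * v z) : ℝ) * Complex.I)
    + (1 - (π n z : ℂ)) *
      Complex.exp (((0 - π n z) * ((r n)⁻¹ * v z) : ℝ) * Complex.I) with hG
  set s : EuclideanSpace ℝ (Fin p) → ℝ := fun z => inner ℝ θ (stack 1 z) with hs
  set K := Real.exp (‖θ‖ * b) with hK
  set m := ‖t‖ * b with hm
  have hvm : Measurable v := (measurable_stack 1).const_inner
  have hGm : ∀ n, Measurable (G n) := fun n => by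
    have := hπm n
    simp only [hG]
    fun_prop
  have hb0 : 0 ≤ b := by
    obtain ⟨z, hz⟩ := hb.exists
    exact (norm_nonneg _).trans hz
  have hm0 : 0 ≤ m := by positivity
  have hK0 : 0 < K := Real.exp_pos _
  have hclose : ∀ᶠ n in atTop, ∀ z, ‖stack 1 z‖ ≤ b →
      ‖(N n : ℂ) * (G n z - 1) + ((linkWeight (q n) (s z) * v z ^ 2 / 2 : ℝ) : ℂ)‖
        ≤ 2 * K * m ^ 3 * (r n)⁻¹ := by
    filter_upwards [hq, hr2, hπ, hr.eventually_ge_atTop (max 1 m)] with n hqn hrn hπn hrm z hz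
    have hr1 : 1 ≤ r n := (le_max_left _ _).trans hrm
    have hrm' : m ≤ r n := (le_max_right _ _).trans hrm
    have hr0 : 0 < r n := by linarith
    have hvz : |v z| ≤ m := abs_inner_stack_le hz t
    have hy : |(r n)⁻¹ * v z| = (r n)⁻¹ * |v z| := by
      rw [abs_mul, abs_of_pos (inv_pos.2 hr0)]
    have hy1 : |(r n)⁻¹ * v z| ≤ 1 := by
      rw [hy, inv_mul_le_one₀ hr0]
      exact hvz.trans hrm'
    have hB := norm_bernoulli_charFun_sub_le (hπ01 n z) hy1
    have hpos := one_add_mul_exp_pos hqn.le (s z)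
    -- The Bernoulli variance is `q` times `linkWeight q`, and `N q / r² = 1`.
    have hw : (N n : ℝ) * (π n z * (1 - π n z) * ((r n)⁻¹ * v z) ^ 2 / 2) =
        linkWeight (q n) (s z) * v z ^ 2 / 2 := by
      rw [hπn z, linkWeight, mul_pow, inv_pow, hrn]
      have hNn : (N n : ℝ) ≠ 0 := fun h0 => by
        rw [h0, zero_mul] at hrn
        exact (pow_pos hr0 2).ne' hrn
      simp only [hs] at hpos ⊢
      have := hqn.ne'
      field_simp
      ring
    have heq : (N n : ℂ) * (G n z - 1) + ((linkWeight (q n) (s z) * v z ^ 2 / 2 : ℝ) : ℂ) =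
        (N n : ℂ) * (G n z - 1 + ((π n z * (1 - π n z) * ((r n)⁻¹ * v z) ^ 2 / 2 : ℝ) : ℂ)) := by
      rw [← hw]
      push_cast
      ring
    have hπle : π n z ≤ q n * K := by
      rw [hπn z]
      refine (div_le_self (by positivity) (one_le_one_add_mul_exp hqn.le _)).trans ?_
      gcongr
      exact Real.exp_le_exp.2 (abs_le.1 (abs_inner_stack_le hz θ)).2
    rw [heq, norm_mul, Complex.norm_natCast]
    calc (N n : ℝ) * ‖G n z - 1 + ((π n z * (1 - π n z) * ((r n)⁻¹ * v z) ^ 2 / 2 : ℝ) : ℂ)‖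
        ≤ (N n : ℝ) * (2 * π n z * |(r n)⁻¹ * v z| ^ 3) := by gcongr
      _ ≤ (N n : ℝ) * (2 * (q n * K) * ((r n)⁻¹ * m) ^ 3) := by
          rw [hy]
          gcongr
      _ = (N n * q n) * (2 * K * m ^ 3) * (r n)⁻¹ ^ 3 := by ring
      _ = 2 * K * m ^ 3 * (r n)⁻¹ := by
          rw [← hrn]
          field_simp
  have hlimF : Tendsto (fun n => ∫ z, (N n : ℂ) * (G n z - 1) ∂ν) atTop
      (𝓝 (∫ z, (-(linkWeight q' (s z) * v z ^ 2 / 2 : ℝ) : ℂ) ∂ν)) := by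
    refine tendsto_integral_filter_of_dominated_convergence
      (fun _ => 2 * K * m ^ 3 + K * m ^ 2 / 2)
      (Eventually.of_forall fun n => (((hGm n).sub_const 1).const_mul _).aestronglyMeasurable)
      ?_ (integrable_const _) ?_
    · filter_upwards [hclose, hq, hr.eventually_ge_atTop 1] with n hn hqn hr1
      filter_upwards [hb] with z hz
      have h1 : ‖((linkWeight (q n) (s z) * v z ^ 2 / 2 : ℝ) : ℂ)‖ ≤ K * m ^ 2 / 2 := by
        have hw0 := linkWeight_nonneg (q n) (s z)
        rw [Complex.norm_real, Real.norm_of_nonneg (by positivity), ← sq_abs]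
        gcongr
        · exact linkWeight_inner_stack_le hqn.le hz
        · exact abs_inner_stack_le hz t
      have h2 : 2 * K * m ^ 3 * (r n)⁻¹ ≤ 2 * K * m ^ 3 :=
        mul_le_of_le_one_right (by positivity) (inv_le_one_of_one_le₀ hr1)
      calc ‖(N n : ℂ) * (G n z - 1)‖
          = ‖((N n : ℂ) * (G n z - 1) + ((linkWeight (q n) (s z) * v z ^ 2 / 2 : ℝ) : ℂ))
            - ((linkWeight (q n) (s z) * v z ^ 2 / 2 : ℝ) : ℂ)‖ := by rw [add_sub_cancel_right]
        _ ≤ _ := (norm_sub_le _ _).trans (add_le_add ((hn z hz).trans h2) h1)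
    · filter_upwards [hb] with z hz
      have h1 : Tendsto (fun n => (N n : ℂ) * (G n z - 1)
          + ((linkWeight (q n) (s z) * v z ^ 2 / 2 : ℝ) : ℂ)) atTop (𝓝 0) := by
        refine squeeze_zero_norm' (a := fun n => 2 * K * m ^ 3 * (r n)⁻¹) ?_ ?_
        · filter_upwards [hclose] with n hn using hn z hz
        · simpa using hr.inv_tendsto_atTop.const_mul (2 * K * m ^ 3)
      have h2 : Tendsto (fun n => ((linkWeight (q n) (s z) * v z ^ 2 / 2 : ℝ) : ℂ)) atTop
          (𝓝 ((linkWeight q' (s z) * v z ^ 2 / 2 : ℝ) : ℂ)) := by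
        refine (Complex.continuous_ofReal.tendsto _).comp ?_
        refine Tendsto.div_const (Tendsto.mul_const _ ?_) _
        unfold linkWeight
        exact Tendsto.div tendsto_const_nhds (((hqq.mul_const _).const_add 1).pow 2)
          (pow_pos (one_add_mul_exp_pos hq' _) 2).ne'
      have := h1.sub h2
      rw [zero_sub] at this
      exact this.congr fun n => by ring
  have hGi : ∀ n, Integrable (G n) ν := fun n => by
    refine Integrable.of_bound (hGm n).aestronglyMeasurable 2 (ae_of_all _ fun z => ?_)
    obtain ⟨h0, h1⟩ := hπ01 n z
    have hn1 : ‖(1 - (π n z : ℂ))‖ ≤ 1 := by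
      rw [← Complex.ofReal_one, ← Complex.ofReal_sub, Complex.norm_real, Real.norm_eq_abs, abs_le]
      constructor <;> linarith
    refine (norm_add_le _ _).trans ?_
    rw [norm_mul, norm_mul, Complex.norm_exp_ofReal_mul_I, Complex.norm_exp_ofReal_mul_I,
      Complex.norm_real, Real.norm_of_nonneg h0]
    linarith
  have hval : ∫ z, (-(linkWeight q' (s z) * v z ^ 2 / 2 : ℝ) : ℂ) ∂ν =
      (-(inner ℝ t (Matrix.toEuclideanCLM (𝕜 := ℝ) (info ν θ q') t) / 2 : ℝ) : ℂ) := by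
    rw [integral_neg, integral_complex_ofReal, inner_toEuclideanCLM_info hq' hb t,
      integral_div]
    simp only [hv, hs, mul_comm]
  rw [hval] at hlimF
  have hlim : Tendsto (fun n => (N n : ℂ) * (∫ z, G n z ∂ν - 1)) atTop
      (𝓝 (-(inner ℝ t (Matrix.toEuclideanCLM (𝕜 := ℝ) (info ν θ q') t) / 2 : ℝ) : ℂ)) := by
    refine hlimF.congr fun n => ?_
    rw [integral_const_mul, integral_sub (hGi n) (integrable_const _)]
    simp
  refine (tendsto_one_add_pow_exp_of_tendsto_mul hN hlim).congr fun n => ?_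
  rw [add_sub_cancel]

/-! ### Convexity and quadratic approximation of the negative log-likelihood -/

/-- The normalized score of the log-likelihood at the parameter `(μd, γ)`. -/
noncomputable def score (n : ℕ) (ξ μd : ℝ) (γ : EuclideanSpace ℝ (Fin p)) (r : ℝ)
    (z : Dyad n → EuclideanSpace ℝ (Fin p)) (a : Dyad n → Bool) :
    EuclideanSpace ℝ (Fin (p + 1)) :=
  r⁻¹ • ∑ e, ((if a e = true then (1 : ℝ) else 0) - linkProb n ξ μd γ (z e)) • stack 1 (z e)

/-- The empirical version of `info`. -/
noncomputable def empInfo (n : ℕ) (z : Dyad n → EuclideanSpace ℝ (Fin p))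
    (θ : EuclideanSpace ℝ (Fin (p + 1))) (q : ℝ) (k l : Fin (p + 1)) : ℝ :=
  (Fintype.card (Dyad n) : ℝ)⁻¹ *
    ∑ e, stack 1 (z e) k * stack 1 (z e) l * linkWeight q (inner ℝ θ (stack 1 (z e)))

lemma linkProb_eq {n : ℕ} (hn : n ≠ 0) (ξ μd : ℝ) (γ z : EuclideanSpace ℝ (Fin p)) :
    linkProb n ξ μd γ z = (n : ℝ) ^ (-ξ) * Real.exp (inner ℝ (stack μd γ) (stack 1 z)) /
      (1 + (n : ℝ) ^ (-ξ) * Real.exp (inner ℝ (stack μd γ) (stack 1 z))) := by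
  have hn' : (0 : ℝ) < n := by exact_mod_cast Nat.pos_of_ne_zero hn
  have h : Real.exp ((-ξ * Real.log n + μd) + inner ℝ γ z) =
      (n : ℝ) ^ (-ξ) * Real.exp (inner ℝ (stack μd γ) (stack 1 z)) := by
    rw [inner_stack_one, stack_zero, slope_stack, Real.rpow_def_of_pos hn', ← Real.exp_add]
    ring_nf
  rw [linkProb, h]

lemma negLogLik_eq_sum (n : ℕ) (ξ : ℝ) (z : Dyad n → EuclideanSpace ℝ (Fin p))
    (a : Dyad n → Bool) (θ : EuclideanSpace ℝ (Fin (p + 1))) :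
    negLogLik n ξ z a θ = ∑ e, (-(if a e = true then (1 : ℝ) else 0) * inner ℝ θ (stack 1 (z e)) +
      Real.log (1 + (n : ℝ) ^ (-ξ) * Real.exp (inner ℝ θ (stack 1 (z e))))) := by
  simp only [negLogLik, inner_stack_one, Finset.sum_add_distrib, add_left_inj]
  rw [← Finset.sum_neg_distrib, Finset.sum_mul, ← Finset.sum_sub_distrib]
  exact Finset.sum_congr rfl fun e _ => by ring

lemma convexOn_negLogLik (n : ℕ) (ξ : ℝ) (z : Dyad n → EuclideanSpace ℝ (Fin p))
    (a : Dyad n → Bool) : ConvexOn ℝ Set.univ (negLogLik n ξ z a) := by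
  have hq : (0 : ℝ) ≤ (n : ℝ) ^ (-ξ) := by positivity
  have hterm : ∀ e : Dyad n, ConvexOn ℝ Set.univ fun θ : EuclideanSpace ℝ (Fin (p + 1)) =>
      -(if a e = true then (1 : ℝ) else 0) * inner ℝ θ (stack 1 (z e)) +
      Real.log (1 + (n : ℝ) ^ (-ξ) * Real.exp (inner ℝ θ (stack 1 (z e)))) := fun e => by
    have hlin : ConvexOn ℝ Set.univ fun s : ℝ =>
        -(if a e = true then (1 : ℝ) else 0) * s + Real.log (1 + (n : ℝ) ^ (-ξ) * Real.exp s) :=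
      ((LinearMap.mulLeft ℝ (-(if a e = true then (1 : ℝ) else 0))).convexOn convex_univ).add
        (convexOn_log_one_add_mul_exp hq)
    have := hlin.comp_linearMap (innerₗ (EuclideanSpace ℝ (Fin (p + 1))) (stack 1 (z e)))
    convert! this using 1
    ext θ
    simp [real_inner_comm]
  have hsum : ∀ s : Finset (Dyad n), ConvexOn ℝ Set.univ
      fun θ : EuclideanSpace ℝ (Fin (p + 1)) =>
      ∑ e ∈ s, (-(if a e = true then (1 : ℝ) else 0) * inner ℝ θ (stack 1 (z e)) +
      Real.log (1 + (n : ℝ) ^ (-ξ) * Real.exp (inner ℝ θ (stack 1 (z e))))) := fun s => by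
    classical
    induction s using Finset.induction_on with
    | empty => simpa using convexOn_const (0 : ℝ) convex_univ
    | insert e s he ih =>
      simp only [Finset.sum_insert he]
      exact (hterm e).add ih
  rw [funext (negLogLik_eq_sum n ξ z a)]
  exact hsum Finset.univ

lemma convexOn_negLogLik_rescaled (n : ℕ) (ξ : ℝ) (z : Dyad n → EuclideanSpace ℝ (Fin p))
    (a : Dyad n → Bool) (θ : EuclideanSpace ℝ (Fin (p + 1))) (r : ℝ) :
    ConvexOn ℝ Set.univ fun u => negLogLik n ξ z a (θ + r • u) - negLogLik n ξ z a θ := by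
  have := ((convexOn_negLogLik n ξ z a).translate_right θ).comp_linearMap
    (r • LinearMap.id : EuclideanSpace ℝ (Fin (p + 1)) →ₗ[ℝ] EuclideanSpace ℝ (Fin (p + 1)))
  simp only [Set.preimage_univ] at this
  convert! this.sub (concaveOn_const (negLogLik n ξ z a θ) convex_univ) using 1

/-- Local quadratic approximation of the rescaled negative log-likelihood. -/
lemma abs_negLogLik_sub_quadratic_le {n : ℕ} {ξ μd : ℝ} {γ : EuclideanSpace ℝ (Fin p)}
    {z : Dyad n → EuclideanSpace ℝ (Fin p)} (a : Dyad n → Bool) {b : ℝ}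
    (hz : ∀ e, ‖stack 1 (z e)‖ ≤ b) (hn : n ≠ 0) {r : ℝ} (hr : 0 < r)
    (hr2 : r ^ 2 = n.choose 2 * (n : ℝ) ^ (-ξ)) (S : Matrix (Fin (p + 1)) (Fin (p + 1)) ℝ) {δ : ℝ}
    (hδ : ∀ k l, |empInfo n z (stack μd γ) ((n : ℝ) ^ (-ξ)) k l - S k l| ≤ δ)
    {R : ℝ} (hb : 0 ≤ b) (hRr : R ≤ r) {u : EuclideanSpace ℝ (Fin (p + 1))} (hu : ‖u‖ ≤ R) :
    |negLogLik n ξ z a (stack μd γ + r⁻¹ • u) - negLogLik n ξ z a (stack μd γ) -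
      (-inner ℝ (score n ξ μd γ r z a) u +
        inner ℝ u (Matrix.toEuclideanCLM (𝕜 := ℝ) S u) / 2)| ≤
      (p + 1) ^ 2 * δ * R ^ 2 / 2 + Real.exp ((‖stack μd γ‖ + 1) * b) * (R * b) ^ 3 * r⁻¹ := by
  set q : ℝ := (n : ℝ) ^ (-ξ) with hq
  set θ := stack μd γ with hθ
  have hn' : (0 : ℝ) < n := by exact_mod_cast Nat.pos_of_ne_zero hn
  have hq0 : 0 < q := Real.rpow_pos_of_pos hn' _
  have hR : 0 ≤ R := (norm_nonneg u).trans hu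
  have hcard : (Fintype.card (Dyad n) : ℝ) = n.choose 2 := by rw [card_dyad]
  have hN0 : (n.choose 2 : ℝ) ≠ 0 := fun h0 => by
    rw [h0, zero_mul] at hr2
    exact (pow_pos hr 2).ne' hr2
  set s : Dyad n → ℝ := fun e => inner ℝ θ (stack 1 (z e)) with hs
  set h : Dyad n → ℝ := fun e => r⁻¹ * inner ℝ u (stack 1 (z e)) with hh
  have hsh : ∀ e, inner ℝ (θ + r⁻¹ • u) (stack 1 (z e)) = s e + h e := fun e => by
    rw [inner_add_left, real_inner_smul_left]
  set rem : Dyad n → ℝ := fun e => Real.log (1 + q * Real.exp (s e + h e))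
    - Real.log (1 + q * Real.exp (s e)) - q * Real.exp (s e) / (1 + q * Real.exp (s e)) * h e
    - q * linkWeight q (s e) * h e ^ 2 / 2 with hrem
  have hhle : ∀ e, |h e| ≤ r⁻¹ * (R * b) := fun e => by
    rw [hh, abs_mul, abs_of_pos (inv_pos.2 hr)]
    gcongr
    exact (abs_inner_stack_le (hz e) u).trans (by gcongr)
  have hremle : ∀ e, |rem e| ≤ q * Real.exp ((‖θ‖ + 1) * b) * (r⁻¹ * (R * b)) ^ 3 := fun e => by
    have h1 : |s e| ≤ ‖θ‖ * b := abs_inner_stack_le (hz e) θ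
    -- Since `R ≤ r`, the increment is at most `b`, so both arguments stay in the fixed interval of
    -- radius `(‖θ‖ + 1) b`.
    have h2 : |h e| ≤ b := (hhle e).trans <| by
      rw [← mul_assoc]
      refine mul_le_of_le_one_left hb ?_
      rwa [inv_mul_le_one₀ hr]
    have := abs_log_one_add_mul_exp_taylor_le (q := q) (B := (‖θ‖ + 1) * b) (s := s e)
      (t := s e + h e) hq0.le (by linarith) ((abs_add_le _ _).trans (by linarith))
    rw [add_sub_cancel_left] at this
    refine this.trans ?_
    gcongr
    exact hhle e
  have hlin : ∑ e, (q * Real.exp (s e) / (1 + q * Real.exp (s e))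
      - (if a e = true then (1 : ℝ) else 0)) * h e = -inner ℝ (score n ξ μd γ r z a) u := by
    rw [score, real_inner_smul_left, sum_inner, Finset.mul_sum, ← Finset.sum_neg_distrib]
    refine Finset.sum_congr rfl fun e _ => ?_
    rw [real_inner_smul_left, linkProb_eq hn, real_inner_comm u]
    simp only [hh, hs]
    ring
  have hquad : ∑ e, q * linkWeight q (s e) * h e ^ 2 / 2 =
      (∑ k, ∑ l, u k * u l * empInfo n z θ q k l) / 2 := by
    have h1 : ∀ e, q * linkWeight q (s e) * h e ^ 2 / 2 =
        (∑ k, ∑ l, u k * u l * ((Fintype.card (Dyad n) : ℝ)⁻¹ *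
          (stack 1 (z e) k * stack 1 (z e) l * linkWeight q (s e)))) / 2 := fun e => by
      -- The choice of `r` turns the second-order term into an average over the dyads, that is, into
      -- `empInfo`.
      have h2 : q * (r⁻¹) ^ 2 = (Fintype.card (Dyad n) : ℝ)⁻¹ := by
        rw [hcard, inv_pow, hr2]
        field_simp
      have h3 : inner ℝ u (stack 1 (z e)) ^ 2 =
          ∑ k, ∑ l, u k * u l * (stack 1 (z e) k * stack 1 (z e) l) := by
        rw [sq, PiLp.inner_apply, Finset.sum_mul_sum]
        refine Finset.sum_congr rfl fun k _ => Finset.sum_congr rfl fun l _ => ?_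
        simp
        ring
      rw [← h2, hh, mul_pow, h3]
      simp only [Finset.mul_sum]
      congr 1
      exact Finset.sum_congr rfl fun k _ => Finset.sum_congr rfl fun l _ => by ring
    rw [Finset.sum_congr rfl fun e _ => h1 e, ← Finset.sum_div, Finset.sum_comm]
    congr 1
    refine Finset.sum_congr rfl fun k _ => ?_
    rw [Finset.sum_comm]
    refine Finset.sum_congr rfl fun l _ => ?_
    rw [empInfo, Finset.mul_sum, Finset.mul_sum]
  have hS : inner ℝ u (Matrix.toEuclideanCLM (𝕜 := ℝ) S u) = ∑ k, ∑ l, u k * u l * S k l := by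
    rw [Matrix.inner_toEuclideanCLM]
    simp only [dotProduct, Matrix.mulVec, Finset.mul_sum]
    exact Finset.sum_congr rfl fun k _ => Finset.sum_congr rfl fun l _ => by ring
  have hdiff : negLogLik n ξ z a (θ + r⁻¹ • u) - negLogLik n ξ z a θ -
      (-inner ℝ (score n ξ μd γ r z a) u +
        inner ℝ u (Matrix.toEuclideanCLM (𝕜 := ℝ) S u) / 2) =
      (∑ k, ∑ l, u k * u l * (empInfo n z θ q k l - S k l)) / 2 + ∑ e, rem e := by
    rw [hS, ← hlin]
    have h4 : ∑ k, ∑ l, u k * u l * (empInfo n z θ q k l - S k l) =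
        ∑ k, ∑ l, u k * u l * empInfo n z θ q k l - ∑ k, ∑ l, u k * u l * S k l := by
      simp only [mul_sub, Finset.sum_sub_distrib]
    rw [h4, sub_div, ← hquad, negLogLik_eq_sum, negLogLik_eq_sum]
    simp only [hsh]
    rw [← Finset.sum_sub_distrib]
    have h5 : ∑ e, (-(if a e = true then (1 : ℝ) else 0) * (s e + h e) +
        Real.log (1 + q * Real.exp (s e + h e)) -
        (-(if a e = true then (1 : ℝ) else 0) * s e + Real.log (1 + q * Real.exp (s e)))) =
        ∑ e, (q * Real.exp (s e) / (1 + q * Real.exp (s e))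
          - (if a e = true then (1 : ℝ) else 0)) * h e +
        ∑ e, q * linkWeight q (s e) * h e ^ 2 / 2 + ∑ e, rem e := by
      rw [← Finset.sum_add_distrib, ← Finset.sum_add_distrib]
      refine Finset.sum_congr rfl fun e _ => ?_
      simp only [hrem]
      ring
    rw [h5]
    ring
  have hδ0 : 0 ≤ δ := (abs_nonneg _).trans (hδ 0 0)
  have hb1 : |∑ k, ∑ l, u k * u l * (empInfo n z θ q k l - S k l)| ≤ (p + 1) ^ 2 * δ * R ^ 2 := by
    calc _ ≤ ∑ _k : Fin (p + 1), ∑ _l : Fin (p + 1), R * R * δ := by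
          refine (Finset.abs_sum_le_sum_abs _ _).trans (Finset.sum_le_sum fun k _ => ?_)
          refine (Finset.abs_sum_le_sum_abs _ _).trans (Finset.sum_le_sum fun l _ => ?_)
          rw [abs_mul, abs_mul]
          gcongr
          · exact (abs_coord_le_norm u k).trans hu
          · exact (abs_coord_le_norm u l).trans hu
          · exact hδ k l
      _ = _ := by simp; ring
  have hb2 : |∑ e, rem e| ≤ Real.exp ((‖θ‖ + 1) * b) * (R * b) ^ 3 * r⁻¹ := by
    calc _ ≤ ∑ _e : Dyad n, q * Real.exp ((‖θ‖ + 1) * b) * (r⁻¹ * (R * b)) ^ 3 :=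
          (Finset.abs_sum_le_sum_abs _ _).trans (Finset.sum_le_sum fun e _ => hremle e)
      _ = (n.choose 2 * q) * Real.exp ((‖θ‖ + 1) * b) * (r⁻¹ * (R * b)) ^ 3 := by
          rw [Finset.sum_const, Finset.card_univ, nsmul_eq_mul, hcard]; ring
      _ = _ := by
          rw [← hr2]
          field_simp
  rw [hdiff]
  refine (abs_add_le _ _).trans (add_le_add ?_ hb2)
  rw [abs_div, abs_two]
  gcongr

/-! ### Slutsky's argument and tightness through characteristic functions -/

/-- If `Y n - X n → 0` in probability, the characteristic functions of `X n` and `Y n` have the same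
limits. The variables may live on different probability spaces for different `n`. -/
lemma tendsto_charFun_map_of_sub {E : Type*} [NormedAddCommGroup E] [InnerProductSpace ℝ E]
    [MeasurableSpace E] [BorelSpace E] [SecondCountableTopology E]
    {Ω : ℕ → Type*} [∀ n, MeasurableSpace (Ω n)] {P : ∀ n, Measure (Ω n)}
    [∀ n, IsProbabilityMeasure (P n)] {X Y : ∀ n, Ω n → E} (hX : ∀ n, AEMeasurable (X n) (P n))
    (hY : ∀ n, AEMeasurable (Y n) (P n))
    (hXY : ∀ ε > 0, Tendsto (fun n => P n {ω | ε ≤ ‖Y n ω - X n ω‖}) atTop (𝓝 0)) {t : E} {c : ℂ}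
    (h : Tendsto (fun n => charFun ((P n).map (X n)) t) atTop (𝓝 c)) :
    Tendsto (fun n => charFun ((P n).map (Y n)) t) atTop (𝓝 c) := by
  have hexp : ∀ n {W : Ω n → E}, AEMeasurable W (P n) →
      Integrable (fun ω => Complex.exp (inner ℝ (W ω) t * Complex.I)) (P n) ∧
      charFun ((P n).map W) t = ∫ ω, Complex.exp (inner ℝ (W ω) t * Complex.I) ∂(P n) :=
    fun n W hW => by
      have hm : Measurable fun x : E => Complex.exp (inner ℝ x t * Complex.I) := by fun_prop
      refine ⟨Integrable.of_bound (hm.comp_aemeasurable hW).aestronglyMeasurable 1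
        (ae_of_all _ fun ω => (Complex.norm_exp_ofReal_mul_I _).le), ?_⟩
      rw [charFun_apply, integral_map hW hm.aestronglyMeasurable]
  have hbound : ∀ ε > 0, ∀ n, ‖charFun ((P n).map (Y n)) t - charFun ((P n).map (X n)) t‖ ≤
      ε * ‖t‖ + 2 * (P n).real {ω | ε ≤ ‖Y n ω - X n ω‖} := by
    intro ε hε n
    have hs : NullMeasurableSet {ω | ε ≤ ‖Y n ω - X n ω‖} (P n) :=
      nullMeasurableSet_le aemeasurable_const ((hY n).sub (hX n)).norm
    obtain ⟨hYi, hYe⟩ := hexp n (hY n)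
    obtain ⟨hXi, hXe⟩ := hexp n (hX n)
    rw [hYe, hXe, ← integral_sub hYi hXi]
    have hind : Integrable ({ω | ε ≤ ‖Y n ω - X n ω‖}.indicator fun _ => (2 : ℝ)) (P n) :=
      (integrable_const (2 : ℝ)).indicator₀ hs
    -- On the exceptional event two unimodular numbers differ by at most 2; off it, `|exp (i x) - 1|
    -- ≤ |x|` and Cauchy–Schwarz apply.
    calc _ ≤ ∫ ω, (ε * ‖t‖ + {ω | ε ≤ ‖Y n ω - X n ω‖}.indicator (fun _ => (2 : ℝ)) ω) ∂(P n) := by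
          refine norm_integral_le_of_norm_le ((integrable_const _).add hind)
            (ae_of_all _ fun ω => ?_)
          by_cases hω : ε ≤ ‖Y n ω - X n ω‖
          · rw [Set.indicator_of_mem (by exact hω)]
            have h2 : ‖Complex.exp (inner ℝ (Y n ω) t * Complex.I) -
                Complex.exp (inner ℝ (X n ω) t * Complex.I)‖ ≤ 2 := by
              refine (norm_sub_le _ _).trans ?_
              rw [Complex.norm_exp_ofReal_mul_I, Complex.norm_exp_ofReal_mul_I]
              norm_num
            have : 0 ≤ ε * ‖t‖ := by positivity
            linarith
          · rw [Set.indicator_of_notMem (by exact hω), add_zero]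
            have heq : Complex.exp (inner ℝ (Y n ω) t * Complex.I) -
                Complex.exp (inner ℝ (X n ω) t * Complex.I) =
                Complex.exp (inner ℝ (X n ω) t * Complex.I) *
                  (Complex.exp (Complex.I * (inner ℝ (Y n ω - X n ω) t : ℝ)) - 1) := by
              rw [mul_sub, ← Complex.exp_add, inner_sub_left]
              push_cast
              ring_nf
            rw [heq, norm_mul, Complex.norm_exp_ofReal_mul_I, one_mul]
            refine (Real.norm_exp_I_mul_ofReal_sub_one_le).trans ?_
            refine (norm_inner_le_norm _ _).trans ?_
            gcongr
            exact (not_le.1 hω).le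
      _ = _ := by
          rw [integral_add (integrable_const _) hind, integral_indicator₀ hs]
          simp [mul_comm]
  have hdiff : Tendsto (fun n => charFun ((P n).map (Y n)) t - charFun ((P n).map (X n)) t)
      atTop (𝓝 0) := by
    rw [Metric.tendsto_nhds]
    intro δ hδ
    set ε := δ / (2 * (‖t‖ + 1)) with hε
    have hε0 : 0 < ε := by positivity
    have hεt : ε * ‖t‖ < δ / 2 + δ / 4 := by
      have : ε * (‖t‖ + 1) = δ / 2 := by rw [hε]; field_simp
      nlinarith
    have hreal : Tendsto (fun n => (P n).real {ω | ε ≤ ‖Y n ω - X n ω‖}) atTop (𝓝 0) := by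
      simpa [Function.comp_def, Measure.real] using (ENNReal.tendsto_toReal ENNReal.zero_ne_top).comp (hXY ε hε0)
    filter_upwards [hreal.eventually_lt_const (show (0 : ℝ) < δ / 8 by positivity)] with n hn
    rw [dist_zero_right]
    linarith [hbound ε hε0 n]
  simpa using hdiff.add h

/-- Measures whose characteristic functions converge to a continuous limit have uniformly small
tails. -/
lemma exists_measure_norm_gt_le_of_tendsto_charFun {E : Type*} [NormedAddCommGroup E]
    [InnerProductSpace ℝ E] [FiniteDimensional ℝ E] [MeasurableSpace E] [BorelSpace E]
    {Ω : ℕ → Type*} [∀ n, MeasurableSpace (Ω n)] {P : ∀ n, Measure (Ω n)}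
    [∀ n, IsProbabilityMeasure (P n)] {X : ∀ n, Ω n → E} (hX : ∀ n, AEMeasurable (X n) (P n))
    {f : E → ℂ} (hf : ContinuousAt f 0)
    (h : ∀ t, Tendsto (fun n => charFun ((P n).map (X n)) t) atTop (𝓝 (f t)))
    {δ : ENNReal} (hδ : 0 < δ) : ∃ R : ℝ, 0 ≤ R ∧ ∀ n, P n {ω | R < ‖X n ω‖} ≤ δ := by
  have := fun n => Measure.isProbabilityMeasure_map (hX n)
  have ht := isTightMeasureSet_of_tendsto_charFun hf h
  obtain ⟨K, hK, hle⟩ := isTightMeasureSet_iff_exists_isCompact_measure_compl_le.1 ht δ hδ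
  obtain ⟨R, hR⟩ := hK.isBounded.subset_closedBall (0 : E)
  refine ⟨max R 0, le_max_right _ _, fun n => ?_⟩
  refine le_trans ?_ (hle _ ⟨n, rfl⟩)
  rw [Measure.map_apply_of_aemeasurable (hX n) hK.isClosed.measurableSet.compl]
  refine measure_mono fun ω hω hmem => ?_
  have h1 := mem_closedBall_zero_iff.1 (hR hmem)
  exact absurd hω (not_lt.2 (h1.trans (le_max_left _ _)))

/-! ### Score, empirical information and rate in the model -/

lemma IsERC.measurable_score {Ω : Type*} [MeasurableSpace Ω] {P : Measure Ω}
    {ν : Measure (EuclideanSpace ℝ (Fin p))} {n : ℕ} {ξ μd : ℝ}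
    {γ : EuclideanSpace ℝ (Fin p)} {Z : Dyad n → Ω → EuclideanSpace ℝ (Fin p)}
    {A : Dyad n → Ω → Bool} (h : IsERC P ν n ξ μd γ Z A) (r : ℝ) :
    Measurable fun ω => score n ξ μd γ r (fun e => Z e ω) (fun e => A e ω) := by
  unfold score
  refine (Finset.measurable_fun_sum _ fun e _ => ?_).const_smul r⁻¹
  have hA : Measurable fun ω => if A e ω = true then (1 : ℝ) else 0 :=
    Measurable.ite (h.measurable_link e (measurableSet_singleton true)) measurable_const
      measurable_const
  exact (hA.sub ((measurable_linkProb n ξ μd γ).comp (h.measurable_covariate e))).smul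
    ((measurable_stack 1).comp (h.measurable_covariate e))

lemma IsERC.charFun_score {Ω : Type*} [MeasurableSpace Ω] {P : Measure Ω} [IsProbabilityMeasure P]
    {ν : Measure (EuclideanSpace ℝ (Fin p))} [IsProbabilityMeasure ν] {n : ℕ} {ξ μd : ℝ}
    {γ : EuclideanSpace ℝ (Fin p)} {Z : Dyad n → Ω → EuclideanSpace ℝ (Fin p)}
    {A : Dyad n → Ω → Bool} (h : IsERC P ν n ξ μd γ Z A) (r : ℝ)
    (t : EuclideanSpace ℝ (Fin (p + 1))) :
    charFun (P.map fun ω => score n ξ μd γ r (fun e => Z e ω) (fun e => A e ω)) t =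
      (∫ z, ((linkProb n ξ μd γ z : ℂ) *
        Complex.exp (((1 - linkProb n ξ μd γ z) * (r⁻¹ * inner ℝ t (stack 1 z)) : ℝ) * Complex.I)
      + (1 - (linkProb n ξ μd γ z : ℂ)) *
        Complex.exp (((0 - linkProb n ξ μd γ z) * (r⁻¹ * inner ℝ t (stack 1 z)) : ℝ) *
          Complex.I)) ∂ν) ^ (n.choose 2) := by
  have hm : Measurable fun x : EuclideanSpace ℝ (Fin (p + 1)) =>
    Complex.exp (inner ℝ x t * Complex.I) := by fun_prop
  rw [charFun_apply, integral_map (h.measurable_score r).aemeasurable hm.aestronglyMeasurable]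
  have hv : Measurable fun z : EuclideanSpace ℝ (Fin p) => inner ℝ t (stack 1 z) :=
    (measurable_stack 1).const_inner
  have hfm : ∀ a : Bool, Measurable fun z : EuclideanSpace ℝ (Fin p) => Complex.exp
      ((((if a = true then (1 : ℝ) else 0) - linkProb n ξ μd γ z) *
        (r⁻¹ * inner ℝ t (stack 1 z)) : ℝ) * Complex.I) := fun a =>
    ((Complex.measurable_ofReal.comp (((measurable_linkProb n ξ μd γ).const_sub _).mul
      (hv.const_mul _))).mul_const _).cexp
  have hprod := h.integral_prod hfm fun z a => (Complex.norm_exp_ofReal_mul_I _).le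
  simp only [if_true, Bool.false_eq_true, if_false] at hprod
  rw [← hprod]
  refine integral_congr_ae (ae_of_all _ fun ω => ?_)
  simp only
  rw [← Complex.exp_sum, ← Finset.sum_mul, ← Complex.ofReal_sum, score, real_inner_smul_left,
    sum_inner, Finset.mul_sum]
  congr 3
  refine Finset.sum_congr rfl fun e _ => ?_
  rw [real_inner_smul_left, real_inner_comm t]
  ring

/-- The empirical information matrix converges in probability. -/
lemma tendsto_measure_abs_empInfo_sub_gt {ν : Measure (EuclideanSpace ℝ (Fin p))}
    [IsProbabilityMeasure ν] {b : ℝ} (hb : ∀ᵐ z ∂ν, ‖stack 1 z‖ ≤ b) {ξ μd : ℝ}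
    {γ : EuclideanSpace ℝ (Fin p)} {Ω : ℕ → Type*} [∀ n, MeasurableSpace (Ω n)]
    {P : ∀ n, Measure (Ω n)} [∀ n, IsProbabilityMeasure (P n)]
    {Z : ∀ n, Dyad n → Ω n → EuclideanSpace ℝ (Fin p)} {A : ∀ n, Dyad n → Ω n → Bool}
    (hmodel : ∀ n, IsERC (P n) ν n ξ μd γ (Z n) (A n))
    (hN : Tendsto (fun n : ℕ => n.choose 2) atTop atTop)
    {q : ℕ → ℝ} {q' : ℝ} (hq : ∀ n, 0 ≤ q n) (hq' : 0 ≤ q') (hqq : Tendsto q atTop (𝓝 q'))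
    (θ : EuclideanSpace ℝ (Fin (p + 1))) (k l : Fin (p + 1)) {δ : ℝ} (hδ : 0 < δ) :
    Tendsto (fun n => P n {ω | δ < |empInfo n (fun e => Z n e ω) θ (q n) k l - info ν θ q' k l|})
      atTop (𝓝 0) := by
  set C := b * b * Real.exp (‖θ‖ * b) with hC
  have hlim : Tendsto (fun n : ℕ => ENNReal.ofReal (C ^ 2 / (n.choose 2 * (δ / 2) ^ 2)))
      atTop (𝓝 0) := by
    rw [← ENNReal.ofReal_zero]
    refine ENNReal.tendsto_ofReal (Tendsto.div_atTop tendsto_const_nhds ?_)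
    exact (tendsto_natCast_atTop_atTop.comp hN).atTop_mul_const (by positivity)
  refine tendsto_of_tendsto_of_tendsto_of_le_of_le' tendsto_const_nhds hlim
    (Eventually.of_forall fun _ => zero_le) ?_
  have hinfo := (tendsto_info (θ := θ) (Eventually.of_forall hq) hq' hqq hb k l)
  rw [Metric.tendsto_nhds] at hinfo
  filter_upwards [hinfo (δ / 2) (by positivity), hN.eventually_ge_atTop 1] with n hn hn1
  have : Nonempty (Dyad n) := by
    rw [← Fintype.card_pos_iff, card_dyad]
    exact hn1
  have hcheb := measure_abs_average_sub_integral_ge_le (hmodel n).indep_covariate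
    (hmodel n).law_covariate (measurable_coord_mul_linkWeight (q n) θ k l) (C := C)
    (by filter_upwards [hb] with z hz using abs_coord_mul_linkWeight_le (hq n) hz k l)
    (half_pos hδ)
  rw [card_dyad] at hcheb
  refine (measure_mono fun ω hω => ?_).trans hcheb
  rw [Real.dist_eq] at hn
  have h1 : δ < |empInfo n (fun e => Z n e ω) θ (q n) k l - info ν θ q' k l| := hω
  -- Half of `δ` pays for the deterministic drift of the expected information to its limit, leaving
  -- `δ / 2` for Chebyshev.
  have h2 : δ / 2 ≤ |empInfo n (fun e => Z n e ω) θ (q n) k l - info ν θ (q n) k l| := by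
    have := abs_sub_le (empInfo n (fun e => Z n e ω) θ (q n) k l) (info ν θ (q n) k l)
      (info ν θ q' k l)
    linarith
  simp only [empInfo, card_dyad] at h2
  exact h2

/-- For `n ≥ 2` one has `n.choose 2 ≥ n² / 4`. The case `ξ = 0` also gives the divergence of the
number of dyads. -/
lemma tendsto_choose_two_div_rpow_atTop {ξ : ℝ} (hξ : ξ < 2) :
    Tendsto (fun n : ℕ => (n.choose 2 : ℝ) / (n : ℝ) ^ ξ) atTop atTop := by
  have h : Tendsto (fun n : ℕ => (n : ℝ) ^ (2 - ξ) / 4) atTop atTop :=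
    ((tendsto_rpow_atTop (sub_pos.2 hξ)).comp tendsto_natCast_atTop_atTop).atTop_div_const
      (by norm_num)
  refine tendsto_atTop_mono' _ ?_ h
  filter_upwards [eventually_ge_atTop 2] with n hn
  have hn' : (2 : ℝ) ≤ n := by exact_mod_cast hn
  have hn0 : (0 : ℝ) < n := by linarith
  rw [Real.rpow_sub hn0, Nat.cast_choose_two, Real.rpow_two, div_right_comm]
  refine div_le_div_of_nonneg_right ?_ (by positivity)
  rw [div_le_div_iff₀ (by norm_num) (by norm_num)]
  nlinarith

lemma toEuclideanCLM_mul_apply {d : ℕ} (S T : Matrix (Fin d) (Fin d) ℝ)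
    (x : EuclideanSpace ℝ (Fin d)) :
    Matrix.toEuclideanCLM (𝕜 := ℝ) S (Matrix.toEuclideanCLM (𝕜 := ℝ) T x) =
      Matrix.toEuclideanCLM (𝕜 := ℝ) (S * T) x := by
  rw [map_mul]; rfl

lemma inner_toEuclideanCLM_left {d : ℕ} {S : Matrix (Fin d) (Fin d) ℝ} (hS : S.IsHermitian)
    (x y : EuclideanSpace ℝ (Fin d)) :
    inner ℝ (Matrix.toEuclideanCLM (𝕜 := ℝ) S x) y =
      inner ℝ x (Matrix.toEuclideanCLM (𝕜 := ℝ) S y) := by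
  have h : IsSelfAdjoint (Matrix.toEuclideanCLM (𝕜 := ℝ) S) := by
    have : IsSelfAdjoint S := hS
    exact this.map _
  rw [← ContinuousLinearMap.adjoint_inner_left, h.adjoint_eq]

/-! ### Asymptotic normality of the estimator -/

section MLE

variable {ξ M : ℝ} {Γ : Set (EuclideanSpace ℝ (Fin p))} {μ₀ : ℝ} {γ₀ : EuclideanSpace ℝ (Fin p)}
  {ν : Measure (EuclideanSpace ℝ (Fin p))} [IsProbabilityMeasure ν]
  {Ω : ℕ → Type*} [∀ n, MeasurableSpace (Ω n)] {P : ∀ n, Measure (Ω n)}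
  [∀ n, IsProbabilityMeasure (P n)]
  {Z : ∀ n, Dyad n → Ω n → EuclideanSpace ℝ (Fin p)} {A : ∀ n, Dyad n → Ω n → Bool}
  {r : ℕ → ℝ} {q' : ℝ}

/-- The normalized score is asymptotically normal. -/
lemma tendsto_charFun_score {b : ℝ} (hb : ∀ᵐ z ∂ν, ‖stack 1 z‖ ≤ b)
    (hmodel : ∀ n, IsERC (P n) ν n ξ μ₀ γ₀ (Z n) (A n))
    (hr2 : ∀ n ≠ 0, r n ^ 2 = n.choose 2 * (n : ℝ) ^ (-ξ))
    (hr : Tendsto r atTop atTop) (hN : Tendsto (fun n : ℕ => n.choose 2) atTop atTop)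
    (hq' : 0 ≤ q') (hqq : Tendsto (fun n : ℕ => (n : ℝ) ^ (-ξ)) atTop (𝓝 q'))
    (t : EuclideanSpace ℝ (Fin (p + 1))) :
    Tendsto (fun n => charFun ((P n).map fun ω =>
      score n ξ μ₀ γ₀ (r n) (fun e => Z n e ω) (fun e => A n e ω)) t) atTop
      (𝓝 (Complex.exp (-(inner ℝ t
        (Matrix.toEuclideanCLM (𝕜 := ℝ) (info ν (stack μ₀ γ₀) q') t) / 2 : ℝ)))) := by
  simp_rw [fun n => (hmodel n).charFun_score (r n) t]
  refine tendsto_integral_charFun_pow hb ?_ ?_ hr hN hq' hqq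
    (fun n => measurable_linkProb n ξ μ₀ γ₀) (fun n z => linkProb_mem_Icc n ξ μ₀ γ₀ z) ?_ t
  · filter_upwards [eventually_gt_atTop 0] with n hn
    exact Real.rpow_pos_of_pos (by exact_mod_cast hn) _
  · filter_upwards [eventually_ne_atTop 0] with n hn using hr2 n hn
  · filter_upwards [eventually_ne_atTop 0] with n hn z using linkProb_eq hn ξ μ₀ γ₀ z

/-- The rescaled error of the maximum likelihood estimator is asymptotically equal to the inverse
information matrix applied to the normalized score. -/
lemma tendsto_measure_norm_mle_sub_score {b : ℝ} (hb : ∀ᵐ z ∂ν, ‖stack 1 z‖ ≤ b)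
    (hint : stack μ₀ γ₀ ∈ interior (paramSpace M Γ))
    (hmodel : ∀ n, IsERC (P n) ν n ξ μ₀ γ₀ (Z n) (A n))
    (hr2 : ∀ n ≠ 0, r n ^ 2 = n.choose 2 * (n : ℝ) ^ (-ξ))
    (hr : Tendsto r atTop atTop) (hN : Tendsto (fun n : ℕ => n.choose 2) atTop atTop)
    (hq' : 0 ≤ q') (hqq : Tendsto (fun n : ℕ => (n : ℝ) ^ (-ξ)) atTop (𝓝 q'))
    (hS : (info ν (stack μ₀ γ₀) q').PosDef)
    {θhat : ∀ n, Ω n → EuclideanSpace ℝ (Fin (p + 1))}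
    (hmle : ∀ n, ∀ᵐ ω ∂(P n),
      IsMLE n ξ (paramSpace M Γ) (fun e => Z n e ω) (fun e => A n e ω) (θhat n ω))
    {ε : ℝ} (hε : 0 < ε) :
    Tendsto (fun n => P n {ω | ε ≤ ‖r n • (θhat n ω - stack μ₀ γ₀) -
      Matrix.toEuclideanCLM (𝕜 := ℝ) (info ν (stack μ₀ γ₀) q')⁻¹
        (score n ξ μ₀ γ₀ (r n) (fun e => Z n e ω) (fun e => A n e ω))‖}) atTop (𝓝 0) := by
  set θ := stack μ₀ γ₀ with hθ
  set S := info ν θ q' with hSdef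
  set T := Matrix.toEuclideanCLM (𝕜 := ℝ) S⁻¹ with hT
  have hb0 : 0 ≤ b := by
    obtain ⟨z, hz⟩ := hb.exists
    exact (norm_nonneg _).trans hz
  obtain ⟨c, hc0, hc⟩ := exists_pos_mul_norm_sq_le_of_posDef hS
  obtain ⟨ρ, hρ0, hρ⟩ := Metric.mem_nhds_iff.1 (mem_interior_iff_mem_nhds.1 hint)
  rw [ENNReal.tendsto_nhds_zero]
  intro η hη
  obtain ⟨R, hR0, hR⟩ := exists_measure_norm_gt_le_of_tendsto_charFun
    (fun n => ((hmodel n).measurable_score (r n)).aemeasurable)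
    (f := fun t => Complex.exp (-(inner ℝ t (Matrix.toEuclideanCLM (𝕜 := ℝ) S t) / 2 : ℝ)))
    (Continuous.continuousAt (by fun_prop))
    (fun t => tendsto_charFun_score hb hmodel hr2 hr hN hq' hqq t)
    (ENNReal.half_pos hη.ne')
  -- When the score has norm at most `R`, the ball of radius `R'` about 0 contains the `ε`-ball
  -- about `T U`. The value of `δ` makes the information error `c ε² / 8`; the Taylor remainder gets
  -- `c ε² / 16`, and four times their sum is below `c ε²`.
  set R' := ‖T‖ * R + ε with hR'
  have hR'0 : 0 < R' := by positivity
  set δ := c * ε ^ 2 / (4 * ((p + 1) ^ 2 * R' ^ 2)) with hδ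
  have hδ0 : 0 < δ := by positivity
  have hbad : Tendsto (fun n => ∑ k, ∑ l, P n {ω | δ < |empInfo n (fun e => Z n e ω) θ
      ((n : ℝ) ^ (-ξ)) k l - S k l|}) atTop (𝓝 0) := by
    have : Tendsto (fun n => ∑ k, ∑ l, P n {ω | δ < |empInfo n (fun e => Z n e ω) θ
      ((n : ℝ) ^ (-ξ)) k l - S k l|}) atTop (𝓝 (∑ _k : Fin (p + 1), ∑ _l : Fin (p + 1), 0)) :=
      tendsto_finsetSum _ fun k _ => tendsto_finsetSum _ fun l _ =>
        tendsto_measure_abs_empInfo_sub_gt hb hmodel hN (fun n => by positivity) hq' hqq θ k l hδ0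
    simpa using this
  have hrem : Tendsto (fun n => Real.exp ((‖θ‖ + 1) * b) * (R' * b) ^ 3 * (r n)⁻¹) atTop (𝓝 0) := by
    simpa using hr.inv_tendsto_atTop.const_mul (Real.exp ((‖θ‖ + 1) * b) * (R' * b) ^ 3)
  filter_upwards [hbad.eventually_le_const (ENNReal.half_pos hη.ne'),
    hrem.eventually_lt_const (show 0 < c * ε ^ 2 / 16 by positivity),
    hr.eventually_ge_atTop R', hr.eventually_gt_atTop (R' / ρ), eventually_ne_atTop 0]
    with n hbadn hremn hrn hrρ hn
  have hr0 : 0 < r n := hR'0.trans_le hrn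
  have hZb : ∀ᵐ ω ∂(P n), ∀ e, ‖stack 1 (Z n e ω)‖ ≤ b := ae_all_iff.2 fun e =>
    ae_of_ae_map ((hmodel n).law_covariate e).aemeasurable
      (((hmodel n).law_covariate e).map_eq ▸ hb)
  -- Off the events of a large score or an inaccurate empirical information, the convexity argument
  -- is deterministic.
  have hsub : {ω | ε ≤ ‖r n • (θhat n ω - θ) -
      T (score n ξ μ₀ γ₀ (r n) (fun e => Z n e ω) (fun e => A n e ω))‖} ≤ᵐ[P n]
      ({ω | R < ‖score n ξ μ₀ γ₀ (r n) (fun e => Z n e ω) (fun e => A n e ω)‖} ∪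
        ⋃ k, ⋃ l, {ω | δ < |empInfo n (fun e => Z n e ω) θ ((n : ℝ) ^ (-ξ)) k l - S k l|} :
          Set (Ω n)) := by
    filter_upwards [hmle n, hZb] with ω hω hz
    intro hge
    by_contra hnot
    have hnot' : ω ∉ ({ω | R < ‖score n ξ μ₀ γ₀ (r n) (fun e => Z n e ω) (fun e => A n e ω)‖} ∪
        ⋃ k, ⋃ l, {ω | δ < |empInfo n (fun e => Z n e ω) θ ((n : ℝ) ^ (-ξ)) k l - S k l|} :
          Set (Ω n)) := hnot
    simp only [Set.mem_union, Set.mem_iUnion, Set.mem_ofPred_eq, not_or, not_lt, not_exists]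
      at hnot'
    obtain ⟨hU, hJ⟩ := hnot'
    set U := score n ξ μ₀ γ₀ (r n) (fun e => Z n e ω) (fun e => A n e ω) with hUdef
    have hTV : Matrix.toEuclideanCLM (𝕜 := ℝ) S (T U) = U := by
      rw [hT, toEuclideanCLM_mul_apply, Matrix.mul_nonsing_inv _
        ((Matrix.isUnit_iff_isUnit_det _).1 hS.isUnit), map_one]
      rfl
    have hV : ‖T U‖ ≤ ‖T‖ * R := (T.le_opNorm U).trans (by gcongr)
    have hbound : ∀ u, ‖u - T U‖ ≤ ε → ‖u‖ ≤ R' := fun u hu => by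
      calc ‖u‖ = ‖T U + (u - T U)‖ := by rw [add_sub_cancel]
        _ ≤ ‖T‖ * R + ε := (norm_add_le _ _).trans (add_le_add hV hu)
    refine absurd (show ε ≤ ‖r n • (θhat n ω - θ) - T U‖ from hge) (not_le.2 ?_)
    refine norm_sub_lt_of_convexOn_of_near_quadratic
      (convexOn_negLogLik_rescaled n ξ (fun e => Z n e ω) (fun e => A n e ω) θ (r n)⁻¹)
      (Matrix.toEuclideanCLM (𝕜 := ℝ) S) (inner_toEuclideanCLM_left hS.isHermitian) hc hε
      (η := c * ε ^ 2 / 8 + c * ε ^ 2 / 16) ?_ ?_ ?_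
    · have : 0 < c * ε ^ 2 := by positivity
      linarith
    · intro u hu
      rw [hTV]
      refine (abs_negLogLik_sub_quadratic_le (fun e => A n e ω) hz hn hr0 (hr2 n hn) S hJ hb0 hrn
        (hbound u hu)).trans ?_
      have h1 : (p + 1) ^ 2 * δ * R' ^ 2 / 2 = c * ε ^ 2 / 8 := by
        rw [hδ]
        field_simp
        ring
      rw [h1]
      gcongr
    -- Minimality is used only against this one competitor, which is admissible because the truth is
    -- interior and `r > R' / ρ`; no convexity of `Γ` is involved.
    · have hmem : θ + (r n)⁻¹ • T U ∈ paramSpace M Γ := hρ <| by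
        rw [Metric.mem_ball, dist_eq_norm, add_sub_cancel_left, norm_smul, norm_inv,
          Real.norm_of_nonneg hr0.le, inv_mul_lt_iff₀ hr0]
        have := hbound (T U) (by simpa using hε.le)
        rw [div_lt_iff₀ hρ0] at hrρ
        linarith
      have hmin := hω.2 hmem
      have heq : θ + (r n)⁻¹ • r n • (θhat n ω - θ) = θhat n ω := by
        rw [smul_smul, inv_mul_cancel₀ hr0.ne', one_smul, add_sub_cancel]
      rw [heq]
      exact sub_le_sub_right hmin _
  calc P n _ ≤ _ := measure_mono_ae hsub
    _ ≤ P n {ω | R < ‖score n ξ μ₀ γ₀ (r n) (fun e => Z n e ω) (fun e => A n e ω)‖} +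
        ∑ k, ∑ l, P n {ω | δ < |empInfo n (fun e => Z n e ω) θ ((n : ℝ) ^ (-ξ)) k l - S k l|} := by
      refine (measure_union_le _ _).trans (add_le_add le_rfl ?_)
      refine (measure_iUnion_fintype_le _ _).trans (Finset.sum_le_sum fun k _ => ?_)
      exact measure_iUnion_fintype_le _ _
    _ ≤ η / 2 + η / 2 := add_le_add (hR n) hbadn
    _ = η := ENNReal.add_halves η

/-- Asymptotic normality of the maximum likelihood estimator, with the limit `q'` of `n ^ (-ξ)` as a
parameter. -/
theorem tendstoInDistribution_mle {c : ℝ} (hbdd : ∀ᵐ z ∂ν, ∀ k, |z k| ≤ c) (hξ : ξ < 2)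
    (hint : stack μ₀ γ₀ ∈ interior (paramSpace M Γ))
    (hmodel : ∀ n, IsERC (P n) ν n ξ μ₀ γ₀ (Z n) (A n))
    (hq' : 0 ≤ q') (hqq : Tendsto (fun n : ℕ => (n : ℝ) ^ (-ξ)) atTop (𝓝 q'))
    (hS : (info ν (stack μ₀ γ₀) q').PosDef)
    {θhat : ∀ n, Ω n → EuclideanSpace ℝ (Fin (p + 1))} (hmeas : ∀ n, AEMeasurable (θhat n) (P n))
    (hmle : ∀ n, ∀ᵐ ω ∂(P n),
      IsMLE n ξ (paramSpace M Γ) (fun e => Z n e ω) (fun e => A n e ω) (θhat n ω)) :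
    TendstoInDistribution
      (fun (n : ℕ) ω => Real.sqrt ((n.choose 2 : ℝ) / (n : ℝ) ^ ξ) • (θhat n ω - stack μ₀ γ₀))
      atTop id P (multivariateGaussian 0 (info ν (stack μ₀ γ₀) q')⁻¹) := by
  have hb : ∀ᵐ z ∂ν, ‖stack 1 z‖ ≤ Real.sqrt (1 + p * c ^ 2) := by
    filter_upwards [hbdd] with z hz using norm_stack_one_le hz
  set r : ℕ → ℝ := fun n => Real.sqrt ((n.choose 2 : ℝ) / (n : ℝ) ^ ξ) with hrdef
  set S := info ν (stack μ₀ γ₀) q' with hSdef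
  have hr2 : ∀ n ≠ 0, r n ^ 2 = n.choose 2 * (n : ℝ) ^ (-ξ) := fun n _ => by
    rw [hrdef, Real.sq_sqrt (by positivity), Real.rpow_neg (by positivity), div_eq_mul_inv]
  have hr : Tendsto r atTop atTop :=
    Real.tendsto_sqrt_atTop.comp (tendsto_choose_two_div_rpow_atTop hξ)
  have hN : Tendsto (fun n : ℕ => n.choose 2) atTop atTop := by
    have := tendsto_choose_two_div_rpow_atTop (ξ := 0) (by norm_num)
    simp only [Real.rpow_zero, div_one] at this
    exact tendsto_natCast_atTop_iff.1 this
  have hY : ∀ n, AEMeasurable (fun ω => r n • (θhat n ω - stack μ₀ γ₀)) (P n) := fun n =>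
    ((hmeas n).sub_const _).const_smul (r n)
  have hU := fun n => ((hmodel n).measurable_score (r n)).aemeasurable (μ := P n)
  have hV : ∀ n, AEMeasurable (fun ω => Matrix.toEuclideanCLM (𝕜 := ℝ) S⁻¹
      (score n ξ μ₀ γ₀ (r n) (fun e => Z n e ω) (fun e => A n e ω))) (P n) := fun n =>
    (Matrix.toEuclideanCLM (𝕜 := ℝ) S⁻¹).continuous.measurable.comp_aemeasurable (hU n)
  refine ⟨hY, aemeasurable_id, ProbabilityMeasure.tendsto_iff_tendsto_charFun.2 fun t => ?_⟩
  simp only [ProbabilityMeasure.coe_mk, Measure.map_id]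
  refine tendsto_charFun_map_of_sub hV hY (fun ε hε =>
    tendsto_measure_norm_mle_sub_score hb hint hmodel hr2 hr hN hq' hqq hS hmle hε) ?_
  have hchar : ∀ n, charFun ((P n).map fun ω => Matrix.toEuclideanCLM (𝕜 := ℝ) S⁻¹
      (score n ξ μ₀ γ₀ (r n) (fun e => Z n e ω) (fun e => A n e ω))) t =
      charFun ((P n).map fun ω => score n ξ μ₀ γ₀ (r n) (fun e => Z n e ω) (fun e => A n e ω))
        (Matrix.toEuclideanCLM (𝕜 := ℝ) S⁻¹ t) := fun n => by
    rw [charFun_apply, charFun_apply, integral_map (hV n) (by fun_prop),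
      integral_map (hU n) (by fun_prop)]
    simp only [inner_toEuclideanCLM_left hS.inv.isHermitian]
  simp_rw [hchar]
  convert! tendsto_charFun_score hb hmodel hr2 hr hN hq' hqq
    (Matrix.toEuclideanCLM (𝕜 := ℝ) S⁻¹ t) using 2
  -- The limiting variance in direction `t` is `⟨S⁻¹ t, S S⁻¹ t⟩ = ⟨t, S⁻¹ t⟩`.
  rw [charFun_multivariateGaussian hS.inv.posSemidef, toEuclideanCLM_mul_apply,
    Matrix.mul_nonsing_inv _ ((Matrix.isUnit_iff_isUnit_det _).1 hS.isUnit), map_one,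
    one_apply_eq_self, inner_toEuclideanCLM_left hS.inv.isHermitian,
    Matrix.inner_toEuclideanCLM]
  simp

end MLE

end ERC

theorem mainTheorem3 {p : ℕ} (ξ : ℝ) (hξ : ξ ∈ Set.Ico (0 : ℝ) 2)
    (M : ℝ) (Γ : Set (EuclideanSpace ℝ (Fin p))) (hΓ : IsCompact Γ)
    (μ₀ : ℝ) (γ₀ : EuclideanSpace ℝ (Fin p))
    (hint : ERC.stack μ₀ γ₀ ∈ interior (ERC.paramSpace M Γ))
    (ν : Measure (EuclideanSpace ℝ (Fin p))) [IsProbabilityMeasure ν]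
    (c : ℝ) (hbdd : ∀ᵐ z ∂ν, ∀ k, |z k| ≤ c)
    (hcent : ∀ k, ∫ z, z k ∂ν = 0)
    (hpos : (ERC.secondMoment ν).PosDef)
    (Ω : ℕ → Type*) [∀ n, MeasurableSpace (Ω n)]
    (P : ∀ n, Measure (Ω n)) [∀ n, IsProbabilityMeasure (P n)]
    (Z : ∀ n, ERC.Dyad n → Ω n → EuclideanSpace ℝ (Fin p))
    (A : ∀ n, ERC.Dyad n → Ω n → Bool)
    (hmodel : ∀ n, ERC.IsERC (P n) ν n ξ μ₀ γ₀ (Z n) (A n))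
    (θhat : ∀ n, Ω n → EuclideanSpace ℝ (Fin (p + 1)))
    (hmeas : ∀ n, AEMeasurable (θhat n) (P n))
    (hmle : ∀ n, ∀ᵐ ω ∂(P n),
      ERC.IsMLE n ξ (ERC.paramSpace M Γ) (fun e => Z n e ω) (fun e => A n e ω) (θhat n ω)) :
    (0 < ξ →
      (ERC.sparseInfo ν μ₀ γ₀).PosDef ∧
      TendstoInDistribution
        (fun (n : ℕ) ω =>
          Real.sqrt ((n.choose 2 : ℝ) / (n : ℝ) ^ ξ) • (θhat n ω - ERC.stack μ₀ γ₀))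
        atTop id P (multivariateGaussian 0 (ERC.sparseInfo ν μ₀ γ₀)⁻¹)) ∧
    (ξ = 0 →
      (ERC.logisticInfo ν μ₀ γ₀).PosDef ∧
      TendstoInDistribution
        (fun (n : ℕ) ω =>
          Real.sqrt ((n.choose 2 : ℝ) / (n : ℝ) ^ ξ) • (θhat n ω - ERC.stack μ₀ γ₀))
        atTop id P (multivariateGaussian 0 (ERC.logisticInfo ν μ₀ γ₀)⁻¹)) := by
  rw [ERC.sparseInfo_eq_info, ERC.logisticInfo_eq_info]
  refine ⟨fun h0 => ?_, fun h0 => ?_⟩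
  -- Here `q' = 0`, since `n ^ (-ξ)` tends to 0 for `ξ > 0`; in the second case the sequence is
  -- constantly 1 and `q' = 1`.
  · have hS := ERC.posDef_info (θ := ERC.stack μ₀ γ₀) le_rfl hbdd hcent hpos
    exact ⟨hS, ERC.tendstoInDistribution_mle hbdd hξ.2 hint hmodel le_rfl
      ((tendsto_rpow_neg_atTop h0).comp tendsto_natCast_atTop_atTop) hS hmeas hmle⟩
  · have hS := ERC.posDef_info (θ := ERC.stack μ₀ γ₀) zero_le_one hbdd hcent hpos
    exact ⟨hS, ERC.tendstoInDistribution_mle hbdd hξ.2 hint hmodel zero_le_one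
      (by simp [h0]) hS hmeas hmle⟩
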